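/- **Setting.** Let $\zeta=e^{2\pi i/10}$, $\varphi=(1+\sqrt5)/2$, and let all indices $1,\dots,5$ be read modulo $5$. Let $X\subset\mathbb P^4(\mathbb C)$ be the curve $$x_1^2+x_2^2+x_3^2=0,\qquad \varphi x_1^2+x_2^2+x_4^2=0,\qquad (1+\varphi)x_1^2+x_2^2+x_5^2=0,$$ let $\pi:X\to\mathbb P^1=\mathbb C\cup\{\infty\}$ be $[x_1:\dots:x_5]\mapsto x_2^2/x_1^2$, and let $\eta(x)=\frac{x-\zeta}{x-\zeta^{-1}}\cdot\frac{\zeta^3-\zeta^{-1}}{\zeta-\zeta^3}$. The points of $X$ over $\eta(0)$ are called black, those over $\eta(\infty)$ white. An edge of color $j$ on $X$ is a connected component of $\pi^{-1}(\{\eta(t\zeta^{2j}):0<t<\infty\})$. The face centers for the color pair $(j,j+1)$ are the points of $\pi^{-1}(\eta(\zeta^{2j+1}))$. Let $H^5$ be the hypercube graph on $\{0,1\}^5$, an edge having as color the coordinate that changes along it, and fix a rainbow, that is, a cyclic order $(\rho_1,\dots,\rho_5)$ of the five colors. An embedding of $H^5$ in $X$ is an injective map $\iota$ from the vertices of $H^5$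 to the black and white points of $X$ such that any two vertices joined by an edge of color $\rho_j$ are sent to points in the closure of a common edge of color $j$ on $X$. For vertices $v,u$ let $S_{k,v}(u)\in\{+1,-1\}$ be the $k$-color-splitting with starting vertex $v$: it is $+1$ (resp. $-1$) if every path from $v$ to $u$ uses an even (resp. odd) number of edges of colors $\rho_k$ and $\rho_{k+2}$. Let $\varepsilon_v(u)=+1$ if $u$ and $v$ differ in an even number of coordinates (that is, lie in the same class of the bipartition of $H^5$), and $\varepsilon_v(u)=-1$ otherwise. Let $E_1,E_4:\ y^2=x(x-1)(x-(\varphi+1))$, $E_2,E_5:\ y^2=x(x-1)(x-\varphi)$, $E_3:\ y^2=x(x-1)(x+\varphi)$, over $K_1=K_3=K_4=\mathbb Q(\zeta,i)$ and $K_2=K_5=\mathbb Q(\zeta,i,\sqrt\varphi)$ respectively, and let $\nu_k:X\to E_k$ be the morphism given by the affine coordinates $$\nu_1=\Big(-(2\varphi+1)\tfrac{x_1^2}{x_5^2}-\varphi,\ (2\varphi+1)\tfrac{x_2x_3x_4}{x_5^3}\Big),\quad \nu_2=\Big(\tfrac{x_2^2}{x_1^2}+\varphi+1,\ i\tfrac{x_3x_4x_5}{x_1^3}\Big),$$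 $$\nu_3=\Big((2\varphi+1)\tfrac{x_3^2}{x_2^2}+\varphi+1,\ i(2\varphi+1)\tfrac{x_1x_4x_5}{x_2^3}\Big),\quad \nu_4=\Big((\varphi+1)\tfrac{x_4^2}{x_3^2}-\varphi,\ i\varphi\tfrac{x_1x_2x_5}{x_3^3}\Big),$$ $$\nu_5=\Big(-\tfrac{x_5^2}{x_4^2}+\varphi+1,\ i\tfrac{x_1x_2x_3}{x_4^3}\Big),$$ where points at which the denominators vanish go to the point at infinity $O_k$, the identity of $E_k$. **Theorem.** Fix a rainbow and let $v=(1,1,1,1,1)$. For every black or white point $p$ of $X$ there is an embedding $\iota$ of $H^5$ in $X$ with $\iota(v)=p$. For every embedding $\iota$ and every $k\in\{1,\dots,5\}$, let $G_k\subseteq E_k(\mathbb C)$ be the subgroup generated by the points $\nu_k(\iota(u))$, $u$ a vertex of $H^5$, and $\nu_k(f)$, $f$ a face center. Then $G_k\subseteq MW(E_k)=E_k(K_k)$, and $G_k\cong\mathbb Z\times\mathbb Z/4\times\mathbb Z/2$. More precisely: A. There is an isomorphism $G_k\cong\mathbb Z\times\mathbb Z/4\times\mathbb Z/2$ such that for every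 vertex $u$ the projection of $\nu_k(\iota(u))$ to $\mathbb Z$ is the generator $\varepsilon_v(u)\,S_{k,v}(u)\in\{+1,-1\}$. In particular, within each of the two classes of the bipartition the sign is given, up to a global sign, by the $k$-color-splitting. B. The torsion subgroup of $G_k$ is generated by the images $\nu_k(f)$ of the face centers. The face centers for the color pair $(k+2,k+3)$ are mapped to $O_k$, those for $(k-2,k-1)$ to points of order $4$, and those for each of the three remaining pairs of adjacent colors to points of order $2$. -/

import Mathlib

open scoped LinearAlgebra.Projectivization

noncomputable section

namespace AdinkraH5

/-! Indices. The five colors of the rainbow, the five homogeneous coordinates of the projective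
space and the five elliptic curves are all indexed by `Fin 5` with its arithmetic modulo 5; the
residue classes are named `1, 2, 3, 4, 5`, so that `(5 : Fin 5)` is the same index as `0`. -/

/-! ### The hypercube, rainbows and color splittings -/

/-- Vertices of the hypercube `H^5`. The color of an edge is the coordinate that changes along it,
so that colors are elements of `Fin 5`. -/
abbrev Vertex : Type := Fin 5 → ZMod 2

/-- The neighbour of `v` along the edge of color `c`. -/
def step (v : Vertex) (c : Fin 5) : Vertex := v + Pi.single c 1

/-- The vertex that is reached from `v` by travelling along edges of the listed colors. -/
def walkEnd (v : Vertex) (l : List (Fin 5)) : Vertex := l.foldl step v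

/-- A rainbow `(ρ 1, …, ρ 5)`: an enumeration of the colors, read cyclically. -/
abbrev Rainbow : Type := Fin 5 ≃ Fin 5

/-- The number of edges on a path whose color is `ρ k` or `ρ (k + 2)`. -/
def splitCount (ρ : Rainbow) (k : Fin 5) (l : List (Fin 5)) : ℕ :=
  l.countP fun c => c = ρ k ∨ c = ρ (k + 2)

open Classical in
/-- The label of `w` in the `k`-color-splitting with starting vertex `v`: it is `1` (for `+`) if all
paths from `v` to `w` use an even number of edges of colors `ρ k`, `ρ (k + 2)`, it is `-1` (for `-`)
if all of them use an odd number, and `0` (for `×`) otherwise. -/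
def colorSplit (ρ : Rainbow) (k : Fin 5) (v w : Vertex) : ℤ :=
  if ∀ l, walkEnd v l = w → Even (splitCount ρ k l) then 1
  else if ∀ l, walkEnd v l = w → Odd (splitCount ρ k l) then -1
  else 0

/-- `1` if `v` and `w` lie in the same class (black or white) of the bipartition of `H^5`, that is,
if they differ in an even number of coordinates, and `-1` otherwise. -/
def bipartiteSign (v w : Vertex) : ℤ := (-1) ^ (Finset.univ.filter fun c => v c ≠ w c).card

/-! ### The Riemann surface -/

/-- The tenth root of unity `ζ = exp (2 π i / 10)`. -/
def zeta : ℂ := Complex.exp (2 * Real.pi * Complex.I / 10)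

/-- The golden ratio as a complex number. -/
def phi : ℂ := (Real.goldenRatio : ℂ)

/-- The quotient topology on complex projective space. -/
instance : TopologicalSpace (ℙ ℂ (Fin 5 → ℂ)) :=
  inferInstanceAs (TopologicalSpace (Quotient (projectivizationSetoid ℂ (Fin 5 → ℂ))))

/-- The equations of the curve, for a vector of homogeneous coordinates. -/
def CurveEq (x : Fin 5 → ℂ) : Prop :=
  x 1 ^ 2 + x 2 ^ 2 + x 3 ^ 2 = 0 ∧
  phi * x 1 ^ 2 + x 2 ^ 2 + x 4 ^ 2 = 0 ∧
  (1 + phi) * x 1 ^ 2 + x 2 ^ 2 + x 5 ^ 2 = 0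

/-- The curve `X` in `ℙ⁴(ℂ)`; its equations are homogeneous, so that any representative of a point
may be used to test them. It carries the subspace topology. -/
def Curve : Type := {p : ℙ ℂ (Fin 5 → ℂ) // CurveEq p.rep}

instance : TopologicalSpace Curve :=
  inferInstanceAs (TopologicalSpace {p : ℙ ℂ (Fin 5 → ℂ) // CurveEq p.rep})

/-- Homogeneous coordinates of a point of the curve. Below, they are used only in expressions that
are homogeneous of degree 0. -/
def Curve.coord (p : Curve) : Fin 5 → ℂ := p.1.rep

/-- The projection `[x₁ : … : x₅] ↦ [x₁² : x₂²]` to `ℙ¹(ℂ) = ℂ ∪ {∞}`, where `[1 : z]` is written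
as `z` and `[0 : 1]` as `∞`. -/
def proj (p : Curve) : OnePoint ℂ :=
  if p.coord 1 = 0 then OnePoint.infty else ((p.coord 2 ^ 2 / p.coord 1 ^ 2 : ℂ) : OnePoint ℂ)

/-- The constant factor of the Möbius transformation `eta`. -/
def etaConst : ℂ := (zeta ^ 3 - zeta⁻¹) / (zeta - zeta ^ 3)

/-- The Möbius transformation `η(x) = (x - ζ) / (x - ζ⁻¹) · (ζ³ - ζ⁻¹) / (ζ - ζ³)` of `ℂ ∪ {∞}`. -/
def eta (x : OnePoint ℂ) : OnePoint ℂ :=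
  x.elim (etaConst : OnePoint ℂ) fun z =>
    if z = zeta⁻¹ then OnePoint.infty
    else (((z - zeta) / (z - zeta⁻¹) * etaConst : ℂ) : OnePoint ℂ)

/-- The points over `α₀ = η(0)`. -/
def blackPoints : Set Curve := proj ⁻¹' {eta ((0 : ℂ) : OnePoint ℂ)}

/-- The points over `α_∞ = η(∞)`. -/
def whitePoints : Set Curve := proj ⁻¹' {eta OnePoint.infty}

/-- The open path `γ_j` from `α₀` to `α_∞`: the image under `η` of the open ray through `ζ^(2j)`. -/
def gamma (j : Fin 5) : Set (OnePoint ℂ) :=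
  {z | ∃ t : ℝ, 0 < t ∧ z = eta ((t * zeta ^ (2 * (j : ℕ)) : ℂ) : OnePoint ℂ)}

/-- The (open) edges of color `j` on the surface: the connected components of `π⁻¹(γ_j)`. -/
def edges (j : Fin 5) : Set (Set Curve) :=
  {e | ∃ p ∈ proj ⁻¹' gamma j, e = connectedComponentIn (proj ⁻¹' gamma j) p}

/-- The face centers for the pair of adjacent colors `(j, j + 1)`: the points over
`-α_{j+1} = η(ζ^(2j+1))`. -/
def faceCenters (j : Fin 5) : Set Curve :=
  proj ⁻¹' {eta ((zeta ^ (2 * (j : ℕ) + 1) : ℂ) : OnePoint ℂ)}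

/-- `ι` embeds the hypercube with rainbow `ρ` in the surface: distinct vertices go to distinct
points over `α₀` and `α_∞`, and an edge of color `ρ j` goes to an edge of color `j` on the
surface, having the images of the two vertices as its ends. -/
structure IsAdinkraEmbedding (ρ : Rainbow) (ι : Vertex → Curve) : Prop where
  injective : Function.Injective ι
  mem_vertices : ∀ v, ι v ∈ blackPoints ∪ whitePoints
  edge : ∀ v j, ∃ e ∈ edges j, ι v ∈ closure e ∧ ι (step v (ρ j)) ∈ closure e

/-! ### The elliptic curves -/

/-- The number fields `K_k`: `ℚ(ζ, i)` for `k = 1, 3, 4` and `ℚ(ζ, i, √φ)` for `k = 2, 5`. -/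
def numField (k : Fin 5) : IntermediateField ℚ ℂ :=
  if k = 2 ∨ k = 5 then
    IntermediateField.adjoin ℚ {zeta, Complex.I, ((Real.sqrt Real.goldenRatio : ℝ) : ℂ)}
  else IntermediateField.adjoin ℚ {zeta, Complex.I}

theorem zeta_mem (k : Fin 5) : zeta ∈ numField k := by
  unfold numField
  split_ifs <;> exact IntermediateField.subset_adjoin _ _ (by simp)

theorem phi_eq : phi = zeta + zeta⁻¹ := by
  have h : zeta + zeta⁻¹ = 2 * ((Real.cos (Real.pi / 5) : ℝ) : ℂ) := by
    rw [Complex.ofReal_cos, Complex.two_cos, zeta, ← Complex.exp_neg]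
    congr 2 <;> (push_cast; ring)
  rw [h, Real.cos_pi_div_five, phi, Real.goldenRatio]
  push_cast
  ring

theorem phi_mem (k : Fin 5) : phi ∈ numField k := by
  rw [phi_eq]
  exact add_mem (zeta_mem k) (inv_mem (zeta_mem k))

theorem phi_sq : phi ^ 2 = phi + 1 := by
  unfold phi
  exact_mod_cast Real.goldenRatio_sq

/-- The golden ratio as an element of `K_k`. -/
def phiK (k : Fin 5) : numField k := ⟨phi, phi_mem k⟩

/-- The third finite ramification point of `E_k`. -/
def lam (k : Fin 5) : numField k :=
  if k = 1 ∨ k = 4 then phiK k + 1 else if k = 3 then -phiK k else phiK k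

theorem coe_lam (k : Fin 5) :
    (lam k : ℂ) = if k = 1 ∨ k = 4 then phi + 1 else if k = 3 then -phi else phi := by
  unfold lam phiK
  split_ifs <;> simp

/-- The elliptic curve `E_k : y² = x (x - 1) (x - λ_k)` over `K_k`. -/
def E (k : Fin 5) : WeierstrassCurve (numField k) where
  a₁ := 0
  a₂ := -(1 + lam k)
  a₃ := 0
  a₄ := lam k
  a₆ := 0

/-- The group `E_k(ℂ)`. -/
abbrev EPoint (k : Fin 5) : Type := ((E k).baseChange ℂ).toAffine.Point

/-- The Mordell-Weil group `MW(E_k)` over `K_k`, as a subgroup of `E_k(ℂ)`. -/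
def mordellWeil (k : Fin 5) : AddSubgroup (EPoint k) :=
  (WeierstrassCurve.Affine.Point.map (W' := E k) (Algebra.ofId (numField k) ℂ)).range

/-! ### The maps to the elliptic curves -/

/-- The affine `x`-coordinate of `ν_k`; the last line is the case `k = 5`. -/
def nuX (k : Fin 5) (x : Fin 5 → ℂ) : ℂ :=
  match k with
  | 1 => -(2 * phi + 1) * (x 1 ^ 2 / x 5 ^ 2) - phi
  | 2 => x 2 ^ 2 / x 1 ^ 2 + phi + 1
  | 3 => (2 * phi + 1) * (x 3 ^ 2 / x 2 ^ 2) + phi + 1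
  | 4 => (phi + 1) * (x 4 ^ 2 / x 3 ^ 2) - phi
  | 0 => -(x 5 ^ 2 / x 4 ^ 2) + phi + 1

/-- The affine `y`-coordinate of `ν_k`; the last line is the case `k = 5`. -/
def nuY (k : Fin 5) (x : Fin 5 → ℂ) : ℂ :=
  match k with
  | 1 => (2 * phi + 1) * (x 2 * x 3 * x 4 / x 5 ^ 3)
  | 2 => Complex.I * (x 3 * x 4 * x 5 / x 1 ^ 3)
  | 3 => Complex.I * (2 * phi + 1) * (x 1 * x 4 * x 5 / x 2 ^ 3)
  | 4 => Complex.I * phi * (x 1 * x 2 * x 5 / x 3 ^ 3)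
  | 0 => Complex.I * (x 1 * x 2 * x 3 / x 4 ^ 3)

theorem nu_equation (k : Fin 5) (x : Fin 5 → ℂ) (hx : CurveEq x) (h : x (k - 1) ≠ 0) :
    nuY k x ^ 2 = nuX k x * (nuX k x - 1) * (nuX k x - (lam k : ℂ)) := by
  obtain ⟨h3, h4, h5⟩ := hx
  have hφ := phi_sq
  have hI := Complex.I_sq
  have key : ∀ d : ℂ, d ≠ 0 →
      (x 1 ^ 2 / d ^ 2 + x 2 ^ 2 / d ^ 2 + x 3 ^ 2 / d ^ 2 = 0 ∧
      phi * (x 1 ^ 2 / d ^ 2) + x 2 ^ 2 / d ^ 2 + x 4 ^ 2 / d ^ 2 = 0 ∧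
      (1 + phi) * (x 1 ^ 2 / d ^ 2) + x 2 ^ 2 / d ^ 2 + x 5 ^ 2 / d ^ 2 = 0) ∧ d ^ 2 / d ^ 2 = 1 := by
    intro d hd
    refine ⟨⟨?_, ?_, ?_⟩, div_self (pow_ne_zero 2 hd)⟩
    · linear_combination h3 / d ^ 2
    · linear_combination h4 / d ^ 2
    · linear_combination h5 / d ^ 2
  have prod : ∀ c a b e d : ℂ, (c * (a * b * e / d ^ 3)) ^ 2 =
      c ^ 2 * ((a ^ 2 / d ^ 2) * (b ^ 2 / d ^ 2) * (e ^ 2 / d ^ 2)) := by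
    intro c a b e d
    ring
  fin_cases k
  · have g : ∀ a b c d e : ℂ, a + b + c = 0 → phi * a + b + d = 0 → (1 + phi) * a + b + e = 0 →
        d = 1 → Complex.I ^ 2 * (a * b * c) =
          (-e + phi + 1) * (-e + phi + 1 - 1) * (-e + phi + 1 - phi) := by grind
    have hl : (lam 0 : ℂ) = phi := by rw [coe_lam]; simp
    have h' : x 4 ≠ 0 := h
    obtain ⟨⟨k3, k4, k5⟩, k1⟩ := key _ h'
    change _ = _ * _ * (_ - (lam 0 : ℂ))
    rw [hl]
    exact (prod Complex.I (x 1) (x 2) (x 3) (x 4)).trans (g _ _ _ _ _ k3 k4 k5 k1)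
  · have g : ∀ a b c d e : ℂ, a + b + c = 0 → phi * a + b + d = 0 → (1 + phi) * a + b + e = 0 →
        e = 1 → (2 * phi + 1) ^ 2 * (b * c * d) =
          (-(2 * phi + 1) * a - phi) * (-(2 * phi + 1) * a - phi - 1) *
            (-(2 * phi + 1) * a - phi - (phi + 1)) := by grind
    have hl : (lam 1 : ℂ) = (phi + 1) := by rw [coe_lam]; simp
    have h' : x 5 ≠ 0 := h
    obtain ⟨⟨k3, k4, k5⟩, k1⟩ := key _ h'
    change _ = _ * _ * (_ - (lam 1 : ℂ))
    rw [hl]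
    exact (prod (2 * phi + 1) (x 2) (x 3) (x 4) (x 5)).trans (g _ _ _ _ _ k3 k4 k5 k1)
  · have g : ∀ a b c d e : ℂ, a + b + c = 0 → phi * a + b + d = 0 → (1 + phi) * a + b + e = 0 →
        a = 1 → Complex.I ^ 2 * (c * d * e) =
          (b + phi + 1) * (b + phi + 1 - 1) * (b + phi + 1 - phi) := by grind
    have hl : (lam 2 : ℂ) = phi := by rw [coe_lam]; simp
    have h' : x 1 ≠ 0 := h
    obtain ⟨⟨k3, k4, k5⟩, k1⟩ := key _ h'
    change _ = _ * _ * (_ - (lam 2 : ℂ))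
    rw [hl]
    exact (prod Complex.I (x 3) (x 4) (x 5) (x 1)).trans (g _ _ _ _ _ k3 k4 k5 k1)
  · have g : ∀ a b c d e : ℂ, a + b + c = 0 → phi * a + b + d = 0 → (1 + phi) * a + b + e = 0 →
        b = 1 → (Complex.I * (2 * phi + 1)) ^ 2 * (a * d * e) =
          ((2 * phi + 1) * c + phi + 1) * ((2 * phi + 1) * c + phi + 1 - 1) *
            ((2 * phi + 1) * c + phi + 1 - (-phi)) := by grind
    have hl : (lam 3 : ℂ) = (-phi) := by rw [coe_lam]; simp
    have h' : x 2 ≠ 0 := h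
    obtain ⟨⟨k3, k4, k5⟩, k1⟩ := key _ h'
    change _ = _ * _ * (_ - (lam 3 : ℂ))
    rw [hl]
    exact (prod (Complex.I * (2 * phi + 1)) (x 1) (x 4) (x 5) (x 2)).trans (g _ _ _ _ _ k3 k4 k5 k1)
  · have g : ∀ a b c d e : ℂ, a + b + c = 0 → phi * a + b + d = 0 → (1 + phi) * a + b + e = 0 →
        c = 1 → (Complex.I * phi) ^ 2 * (a * b * e) =
          ((phi + 1) * d - phi) * ((phi + 1) * d - phi - 1) * ((phi + 1) * d - phi - (phi + 1)) := by grind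
    have hl : (lam 4 : ℂ) = (phi + 1) := by rw [coe_lam]; simp
    have h' : x 3 ≠ 0 := h
    obtain ⟨⟨k3, k4, k5⟩, k1⟩ := key _ h'
    change _ = _ * _ * (_ - (lam 4 : ℂ))
    rw [hl]
    exact (prod (Complex.I * phi) (x 1) (x 2) (x 5) (x 3)).trans (g _ _ _ _ _ k3 k4 k5 k1)

theorem lam_ne_zero (k : Fin 5) : lam k ≠ 0 := by
  intro h
  have h' : (lam k : ℂ) = 0 := by rw [h]; simp
  rw [coe_lam] at h'
  have := phi_sq
  split_ifs at h' <;> grind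

theorem lam_ne_one (k : Fin 5) : lam k ≠ 1 := by
  intro h
  have h' : (lam k : ℂ) = 1 := by rw [h]; simp
  rw [coe_lam] at h'
  have := phi_sq
  split_ifs at h' <;> grind

theorem E_disc (k : Fin 5) : (E k).Δ ≠ 0 := by
  have h : (E k).Δ = 16 * lam k ^ 2 * (lam k - 1) ^ 2 := by
    simp only [WeierstrassCurve.Δ, WeierstrassCurve.b₂, WeierstrassCurve.b₄, WeierstrassCurve.b₆,
      WeierstrassCurve.b₈, E]
    ring
  rw [h]
  exact mul_ne_zero (mul_ne_zero (by norm_num) (pow_ne_zero 2 (lam_ne_zero k)))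
    (pow_ne_zero 2 (sub_ne_zero.2 (lam_ne_one k)))

instance (k : Fin 5) : (E k).IsElliptic := ⟨(E_disc k).isUnit⟩

theorem nu_nonsingular (k : Fin 5) (x : Fin 5 → ℂ) (hx : CurveEq x) (h : x (k - 1) ≠ 0) :
    ((E k).baseChange ℂ).toAffine.Nonsingular (nuX k x) (nuY k x) := by
  have hE : ((E k).baseChange ℂ).IsElliptic :=
    inferInstanceAs ((E k).map (algebraMap (numField k) ℂ)).IsElliptic
  refine (WeierstrassCurve.Affine.equation_iff_nonsingular
    (W := ((E k).baseChange ℂ).toAffine)).1 ?_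
  rw [WeierstrassCurve.Affine.equation_iff]
  have := nu_equation k x hx h
  simp only [WeierstrassCurve.baseChange, WeierstrassCurve.map, E, map_zero, map_neg, map_add,
    map_one, IntermediateField.algebraMap_apply]
  linear_combination this

/-- The morphism `ν_k : X → E_k`. The denominator of its affine coordinates is a power of the
coordinate preceding the `k`-th one (cyclically), and the zeros of this coordinate, which are the
poles of the affine coordinates, are sent to the point at infinity of `E_k`. -/
def nu (k : Fin 5) (p : Curve) : EPoint k :=
  if h : p.coord (k - 1) = 0 then 0
  else .some (nuX k p.coord) (nuY k p.coord) (nu_nonsingular k p.coord p.2 h)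

/-- The images in `E_k(ℂ)` of the vertices of the embedded hypercube. -/
def vertexImages (ι : Vertex → Curve) (k : Fin 5) : Set (EPoint k) :=
  Set.range fun v => nu k (ι v)

/-- The images in `E_k(ℂ)` of the face centers. -/
def faceImages (k : Fin 5) : Set (EPoint k) :=
  {P | ∃ j, ∃ f ∈ faceCenters j, nu k f = P}

/-- The subgroup of `E_k(ℂ)` generated by the images of the vertices and the face centers. -/
def imageGroup (ι : Vertex → Curve) (k : Fin 5) : AddSubgroup (EPoint k) :=
  AddSubgroup.closure (vertexImages ι k ∪ faceImages k)

theorem nu_vertex_mem (ι : Vertex → Curve) (k : Fin 5) (v : Vertex) :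
    nu k (ι v) ∈ imageGroup ι k :=
  AddSubgroup.subset_closure (Or.inl ⟨v, rfl⟩)

end AdinkraH5

end

/-! Write π = η(w). Modulo the tenth cyclotomic polynomial the equations of the curve say that, over
η(w), the squares of the coordinates are proportional to c_i (1 - w ζ^(3-2i)) with constants c_i =
`sqCoeff i` (`sq_of_curveEq`). Black points are w = 0, white points are w = ∞, and the coordinate i
vanishes at the face centers for the colors (i-2, i-1).

Along w = t ζ^(2j) the five factors, rescaled, move on segments from 1 to fifth roots of unity.
These segments avoid the negative real axis, so principal square roots lift the path. On a connected
set a continuous square root of a nonvanishing function is unique up to one sign. Hence the edge of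
color j at a black point x ends at the white point with coordinates x_i ζ^(`edgeExp j i`)
(`exists_sign_of_mem_closure`, `edge_ends`, `exists_edge`).

On E_k this crossing takes the x-coordinate φ ζ^e to φ ζ^(-e) and multiplies the y-coordinate by ±
ζ, with sign + exactly for j = k and j = k + 2. Up to that sign it is translation by a fixed
2-torsion point D: ν_k(q) = ± ν_k(p) + D (`nu_acrossEdge`). A walk of length n with m edges of the
two distinguished colors therefore multiplies ν_k by (-1)^n (-1)^m, up to multiples of D, which is
the product of the bipartite sign and the color splitting (`nu_walkEnd`).

A face center has a vanishing coordinate i, and only one. If i = k - 1 it goes to infinity; if i =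
k, to a point T with 2T = D, so of order 4; otherwise y = 0 and the order is 2. With U the image of
a face center for (k, k + 1), U ≠ 2T, and T and U generate all face images (`nu_face_eq`).

A vertex image P has infinite order: at a place over 2 the double of P has a non-integral
x-coordinate, and further doublings make the pole worse (`nu_vertex_not_isOfFinAddOrder`). So P, T,
U generate ℤ × ℤ/4 × ℤ/2 (`exists_addEquiv_closure`). Rationality comes from explicit square roots
in K_k of the cubic at the x-coordinates of P and T.

For existence, the coordinates of all 32 vertices are written down from one of them: crossing an
edge is independent of its color up to signs, and those signs are independent enough over 𝔽₂ to
separate the vertices (`eq_zero_of_edgeFlip`). -/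

noncomputable section

namespace AdinkraH5

/-! ### Curves in Legendre form -/

section Legendre

variable {F : Type*} [Field F]

/-- The Weierstrass curve `W` is given by the equation `y² = x (x - 1) (x - l)`. -/
def IsLegendre (W : WeierstrassCurve.Affine F) (l : F) : Prop :=
  W.a₁ = 0 ∧ W.a₂ = -(1 + l) ∧ W.a₃ = 0 ∧ W.a₄ = l ∧ W.a₆ = 0

variable {W : WeierstrassCurve.Affine F} {l : F}

theorem IsLegendre.equation_iff (hW : IsLegendre W l) (x y : F) :
    W.Equation x y ↔ y ^ 2 = x * (x - 1) * (x - l) := by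
  obtain ⟨h1, h2, h3, h4, h6⟩ := hW
  rw [WeierstrassCurve.Affine.equation_iff, h1, h2, h3, h4, h6]
  constructor <;> intro h <;> linear_combination h

theorem IsLegendre.neg_some (hW : IsLegendre W l) {x y : F} (h : W.Nonsingular x y)
    (h' : W.Nonsingular x (-y)) :
    -(WeierstrassCurve.Affine.Point.some x y h) = .some x (-y) h' := by
  obtain ⟨h1, h2, h3, h4, h6⟩ := hW
  rw [WeierstrassCurve.Affine.Point.neg_some]
  congr 1
  simp [WeierstrassCurve.Affine.negY, h1, h3]

theorem IsLegendre.eq_or_eq_neg (hW : IsLegendre W l) {x y y' : F} (h : W.Nonsingular x y)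
    (h' : W.Nonsingular x y') :
    WeierstrassCurve.Affine.Point.some x y h = .some x y' h' ∨
      WeierstrassCurve.Affine.Point.some x y h = -.some x y' h' := by
  have e : y ^ 2 = y' ^ 2 :=
    ((hW.equation_iff _ _).1 h.1).trans ((hW.equation_iff _ _).1 h'.1).symm
  rcases sq_eq_sq_iff_eq_or_eq_neg.1 e with rfl | rfl
  · exact Or.inl rfl
  · exact Or.inr (hW.neg_some h' h).symm

variable [DecidableEq F]

/-- The translate of `(x, y)` by the `2`-torsion point `(e, 0)`. -/
theorem IsLegendre.add_two_torsion (hW : IsLegendre W l) {x y e x' y' : F}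
    (h : W.Nonsingular x y) (he : W.Nonsingular e 0) (h' : W.Nonsingular x' y') (hx : x ≠ e)
    (hx' : (x' - e) * (x - e) = 3 * e ^ 2 - 2 * (1 + l) * e + l)
    (hy' : y' * (x - e) = -y * (x' - e)) :
    WeierstrassCurve.Affine.Point.some x y h + .some e 0 he = .some x' y' h' := by
  have k := (hW.equation_iff _ _).1 h.1
  have ke := (hW.equation_iff _ _).1 he.1
  obtain ⟨h1, h2, h3, h4, h6⟩ := hW
  have hne : x - e ≠ 0 := sub_ne_zero.2 hx
  rw [WeierstrassCurve.Affine.Point.add_of_X_ne hx,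
    WeierstrassCurve.Affine.Point.some.injEq]
  -- Translation by (e, 0) acts on the x-line as the involution x - e ↦ f'(e) / (x - e), where f is
  -- the cubic; this is `hx'`.
  have X : W.addX x e (W.slope x e y 0) = x' := by
    rw [WeierstrassCurve.Affine.slope_of_X_ne hx, WeierstrassCurve.Affine.addX, h1, h2]
    field_simp
    apply mul_left_cancel₀ hne
    linear_combination (x - e) * k - (x - e) ^ 2 * hx' - (x - e) * ke
  refine ⟨X, ?_⟩
  rw [WeierstrassCurve.Affine.addY, WeierstrassCurve.Affine.negAddY, X,
    WeierstrassCurve.Affine.slope_of_X_ne hx, WeierstrassCurve.Affine.negY, h1, h3]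
  field_simp
  linear_combination -hy'

theorem IsLegendre.add_self_eq_zero (hW : IsLegendre W l) {x : F} (h : W.Nonsingular x 0) :
    WeierstrassCurve.Affine.Point.some x 0 h + .some x 0 h = 0 := by
  obtain ⟨h1, h2, h3, h4, h6⟩ := hW
  exact WeierstrassCurve.Affine.Point.add_self_of_Y_eq
    (by simp [WeierstrassCurve.Affine.negY, h1, h3])

/-- The duplication formula for the `x`-coordinate. -/
theorem IsLegendre.add_self (hW : IsLegendre W l) {x y : F} (h2 : (2 : F) ≠ 0)
    (h : W.Nonsingular x y) (hy : y ≠ 0) :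
    ∃ y' h', WeierstrassCurve.Affine.Point.some x y h + .some x y h =
      .some (((x ^ 2 - l) / (2 * y)) ^ 2) y' h' := by
  have k := (hW.equation_iff _ _).1 h.1
  obtain ⟨g1, g2, g3, g4, g6⟩ := hW
  have hne : y ≠ W.negY x y := by
    simp only [WeierstrassCurve.Affine.negY, g1, g3]
    intro h
    exact mul_ne_zero h2 hy (by linear_combination h)
  rw [WeierstrassCurve.Affine.Point.add_self_of_Y_ne hne]
  have e : W.addX x x (W.slope x x y y) = ((x ^ 2 - l) / (2 * y)) ^ 2 := by
    rw [WeierstrassCurve.Affine.slope_of_Y_ne rfl hne, WeierstrassCurve.Affine.addX,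
      WeierstrassCurve.Affine.negY, g1, g2, g3, g4]
    have : y - (-y - 0 * x - 0) = 2 * y := by ring
    rw [this]
    field_simp
    linear_combination (1 + l - 2 * x) * 4 * k
  have := WeierstrassCurve.Affine.nonsingular_add h h (fun hxy => hne hxy.2)
  rw [e] at this
  refine ⟨_, this, ?_⟩
  congr 1

/-- A point of a Legendre curve whose `x`-coordinate is not integral at a place over `2` has
infinite order: doubling increases the pole order. -/
theorem IsLegendre.not_isOfFinAddOrder {Γ : Type*} [LinearOrderedCommGroupWithZero Γ]
    (v : Valuation F Γ) (v2 : v 2 < 1) (v20 : (2 : F) ≠ 0) (vl : v l ≤ 1) (hW : IsLegendre W l)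
    {x y : F} (h : W.Nonsingular x y) (hx : 1 < v x) :
    ¬ IsOfFinAddOrder (WeierstrassCurve.Affine.Point.some x y h) := by
  -- Here v(y)² = v(x)³ and v(x² - l) = v(x)², so the duplication formula gives v(x(2P)) = v(x) /
  -- v(2)², which exceeds v(x).
  have double : ∀ {x y : F} (h : W.Nonsingular x y), 1 < v x →
      ∃ x' y' h', WeierstrassCurve.Affine.Point.some x y h + .some x y h = .some x' y' h' ∧
        v x < v x' := by
    intro x y h hx
    have k := (hW.equation_iff _ _).1 h.1
    have a1 : v (x - 1) = v x := Valuation.map_sub_eq_of_lt_left v (by rwa [map_one] : v 1 < v x)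
    have a2 : v (x - l) = v x := Valuation.map_sub_eq_of_lt_left v (vl.trans_lt hx)
    have a3 : v (x ^ 2 - l) = v x ^ 2 := by
      rw [← map_pow]
      refine Valuation.map_sub_eq_of_lt_left v ?_
      rw [map_pow]
      exact vl.trans_lt (one_lt_pow₀ hx two_ne_zero)
    have vx : v x ≠ 0 := (zero_lt_one.trans hx).ne'
    have vy : v y ^ 2 = v x ^ 3 := by
      rw [← map_pow, k, map_mul, map_mul, a1, a2]
      simp only [pow_succ, pow_zero, one_mul]
    have hy : y ≠ 0 := by
      rintro rfl
      rw [map_zero, zero_pow two_ne_zero] at vy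
      exact pow_ne_zero 3 vx vy.symm
    obtain ⟨y', h', e⟩ := hW.add_self v20 h hy
    refine ⟨_, y', h', e, ?_⟩
    have v2' : v 2 ≠ 0 := (Valuation.ne_zero_iff v).2 v20
    rw [map_pow, map_div₀, map_mul, a3, div_pow, mul_pow, vy,
      lt_div_iff₀ (mul_pos (pow_pos (zero_lt_iff.2 v2') 2) (pow_pos (zero_lt_iff.2 vx) 3))]
    have : v x * (v 2 ^ 2 * v x ^ 3) = v 2 ^ 2 * (v x ^ 2) ^ 2 := by
      rw [← pow_mul, mul_left_comm, ← pow_succ']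
    rw [this]
    exact mul_lt_of_lt_one_left (pow_pos (pow_pos (zero_lt_iff.2 vx) 2) 2)
      (pow_lt_one₀ zero_le v2 two_ne_zero)
  intro hfin
  set P := WeierstrassCurve.Affine.Point.some x y h with hP
  have seq : ∀ n : ℕ, ∃ x' y' h', (2 ^ n) • P = .some x' y' h' ∧ 1 < v x' := by
    intro n
    induction n with
    | zero => exact ⟨x, y, h, by simp [hP], hx⟩
    | succ n ih =>
      obtain ⟨x', y', h', e, hv⟩ := ih
      obtain ⟨x'', y'', h'', e', hv'⟩ := double h' hv
      exact ⟨x'', y'', h'', by rw [pow_succ, mul_comm, mul_smul, e, two_nsmul, e'],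
        hv.trans hv'⟩
  choose X Y H hX hv using seq
  have mono : StrictMono fun n => v (X n) := by
    refine strictMono_nat_of_lt_succ fun n => ?_
    obtain ⟨x'', y'', h'', e', hv'⟩ := double (H n) (hv n)
    have : (2 ^ (n + 1)) • P = .some x'' y'' h'' := by
      rw [pow_succ, mul_comm, mul_smul, hX n, two_nsmul, e']
    rw [hX (n + 1), WeierstrassCurve.Affine.Point.some.injEq] at this
    rw [this.1]
    exact hv'
  have inj : Function.Injective fun n : ℕ => (2 ^ n) • P := by
    intro m n hmn
    simp only [hX, WeierstrassCurve.Affine.Point.some.injEq] at hmn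
    exact mono.injective (by simp only [hmn.1])
  have fin : (Set.range fun n : ℕ => (2 ^ n) • P).Finite := by
    refine (hfin.finite_multiples).subset ?_
    rintro _ ⟨n, rfl⟩
    exact ⟨2 ^ n, rfl⟩
  exact Set.infinite_range_of_injective inj fin

end Legendre

/-- There is a place of `ℂ` over `2`. -/
theorem exists_valuationSubring_two :
    ∃ V : ValuationSubring ℂ, V.valuation 2 < 1 := by
  let A : Subring ℂ := (Int.castRingHom ℂ).range
  let t : A := ⟨2, 2, by simp⟩
  have hI : Ideal.span {t} ≠ ⊤ := by
    intro h
    rw [Ideal.span_singleton_eq_top] at h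
    obtain ⟨⟨_, n, rfl⟩, hu⟩ := h.exists_right_inv
    have := congrArg Subtype.val hu
    simp only [t, Subring.coe_mul, Subring.coe_one, eq_intCast] at this
    have h2 : (2 * n : ℤ) = 1 := by exact_mod_cast this
    omega
  -- Every proper ideal of a subring of a field lies in the nonunits of some valuation ring; apply
  -- this to (2) in the image of ℤ.
  obtain ⟨V, hV, h⟩ := Ideal.image_subset_nonunits_valuationSubring (Ideal.span {t}) hI
  refine ⟨V, ?_⟩
  have := h ⟨t, Ideal.subset_span rfl, rfl⟩
  exact V.mem_nonunits_iff.1 this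

/-! ### Subgroups of the form `ℤ × ℤ/4 × ℤ/2` -/

section Group

variable {A : Type*} [AddCommGroup A] {P T U : A}

/-- The homomorphism `(n, a, b) ↦ n P + a T + b U`. -/
def genHom (P T U : A) (hT : 4 • T = 0) (hU : 2 • U = 0) : ℤ × ZMod 4 × ZMod 2 →+ A :=
  (zmultiplesHom A P).coprod
    ((ZMod.lift 4 ⟨zmultiplesHom A T, by
      simpa using (by exact_mod_cast hT : (4 : ℤ) • T = 0)⟩).coprod
      (ZMod.lift 2 ⟨zmultiplesHom A U, by
        simpa using (by exact_mod_cast hU : (2 : ℤ) • U = 0)⟩))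

theorem genHom_apply (hT : 4 • T = 0) (hU : 2 • U = 0) (n a b : ℤ) :
    genHom P T U hT hU (n, (a : ZMod 4), (b : ZMod 2)) = n • P + (a • T + b • U) := by
  simp [genHom, ZMod.lift_coe]

/-- Multiplying a relation by 4 leaves 4nP = 0, so n = 0. If b were odd, then U = -aT; doubling
forces a to be even, so U would be 0 or 2T. With b even, aT = 0 and T has order 4. -/
theorem genHom_injective (hT : 4 • T = 0) (hU : 2 • U = 0) (hP : ¬ IsOfFinAddOrder P)
    (hT2 : 2 • T ≠ 0) (hU0 : U ≠ 0) (hUT : U ≠ 2 • T) :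
    Function.Injective (genHom P T U hT hU) := by
  rw [injective_iff_map_eq_zero]
  rintro ⟨n, a, b⟩ h
  obtain ⟨a, rfl⟩ := ZMod.intCast_surjective a
  obtain ⟨b, rfl⟩ := ZMod.intCast_surjective b
  rw [genHom_apply] at h
  have hT' : (4 : ℤ) • T = 0 := by exact_mod_cast hT
  have hU' : (2 : ℤ) • U = 0 := by exact_mod_cast hU
  have h4 : (4 * n) • P = 0 := by
    have h' : (4 : ℤ) • (n • P + (a • T + b • U)) = 0 := by rw [h, smul_zero]
    rw [smul_add, smul_add, smul_comm 4 a T, hT', smul_comm 4 b U,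
      show (4 : ℤ) = 2 * 2 from rfl, mul_smul 2 2 U, hU', smul_zero, smul_zero, smul_zero,
      add_zero, add_zero, smul_smul] at h'
    exact h'
  have hn : n = 0 := by
    by_contra hn
    exact hP (isOfFinAddOrder_iff_zsmul_eq_zero.2 ⟨4 * n, by omega, h4⟩)
  subst hn
  rw [zero_smul, zero_add] at h
  have hb : (b : ZMod 2) = 0 := by
    rcases Int.even_or_odd b with hb | hb
    · exact (ZMod.intCast_zmod_eq_zero_iff_dvd b 2).2 (by exact_mod_cast hb.two_dvd)
    · exfalso
      obtain ⟨b, rfl⟩ := hb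
      rw [add_smul, one_smul, mul_comm, mul_smul, hU', smul_zero, zero_add] at h
      have h2 : (2 * a) • T = 0 := by
        have h' : (2 : ℤ) • (a • T + U) = 0 := by rw [h, smul_zero]
        rwa [smul_add, hU', add_zero, smul_smul] at h'
      rcases Int.even_or_odd a with ha | ha
      · obtain ⟨a, rfl⟩ := ha.two_dvd
        rcases Int.even_or_odd a with ha | ha
        · obtain ⟨a, rfl⟩ := ha.two_dvd
          rw [← mul_assoc, mul_comm, mul_smul, show (2 * 2 : ℤ) = 4 from rfl, hT', smul_zero,
            zero_add] at h
          exact hU0 h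
        · obtain ⟨a, rfl⟩ := ha
          rw [show (2 * (2 * a + 1) : ℤ) = a * 4 + 2 by ring, add_smul, mul_smul, hT', smul_zero,
            zero_add] at h
          apply hUT
          have : (2 : ℤ) • T + (2 : ℤ) • T = 0 := by
            rw [← add_smul]
            exact hT'
          have h3 := h.trans this.symm
          have h4 := add_left_cancel h3
          exact_mod_cast h4
      · obtain ⟨a, rfl⟩ := ha
        rw [show (2 * (2 * a + 1) : ℤ) = a * 4 + 2 by ring, add_smul, mul_smul, hT', smul_zero,
            zero_add] at h2
        exact hT2 (by exact_mod_cast h2)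
  have ha : (a : ZMod 4) = 0 := by
    have hbU : b • U = 0 := by
      obtain ⟨b, rfl⟩ := (ZMod.intCast_zmod_eq_zero_iff_dvd b 2).1 hb
      rw [mul_comm, mul_smul]
      exact (congrArg _ hU').trans (smul_zero _)
    rw [hbU, add_zero] at h
    have : addOrderOf T = 4 :=
      addOrderOf_eq_prime_pow (p := 2) (n := 1) (by simpa using hT2) (by simpa using hT)
    rw [ZMod.intCast_zmod_eq_zero_iff_dvd, ← this]
    exact addOrderOf_dvd_iff_zsmul_eq_zero.2 h
  rw [ha, hb]
  rfl

/-- A group generated by translates of `± P` by multiples of `2 T` and by torsion points from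
`⟨T, U⟩` is isomorphic to `ℤ × ℤ/4 × ℤ/2`. -/
theorem exists_addEquiv_closure (hT : 4 • T = 0) (hU : 2 • U = 0) (hP : ¬ IsOfFinAddOrder P)
    (hT2 : 2 • T ≠ 0) (hU0 : U ≠ 0) (hUT : U ≠ 2 • T) {ι : Type*} (f : ι → A) (s : ι → ℤ)
    (hf : ∀ i, ∃ a : ℤ, f i = s i • P + a • T) (hPf : P ∈ Set.range f) {S : Set A}
    (hTS : T ∈ S) (hUS : U ∈ S) (hS : ∀ Q ∈ S, ∃ a b : ℤ, Q = a • T + b • U) :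
    (∃ Φ : AddSubgroup.closure (Set.range f ∪ S) ≃+ ℤ × ZMod 4 × ZMod 2,
      ∀ i h, (Φ ⟨f i, h⟩).1 = s i) ∧
    ∀ Q : A, Q ∈ AddSubgroup.closure (Set.range f ∪ S) ∧ IsOfFinAddOrder Q ↔
      Q ∈ AddSubgroup.closure S := by
  set ψ := genHom P T U hT hU with hψ
  have inj : Function.Injective ψ := genHom_injective hT hU hP hT2 hU0 hUT
  have hTc : T ∈ AddSubgroup.closure S := AddSubgroup.subset_closure hTS
  have hUc : U ∈ AddSubgroup.closure S := AddSubgroup.subset_closure hUS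
  have le : AddSubgroup.closure S ≤ AddSubgroup.closure (Set.range f ∪ S) :=
    AddSubgroup.closure_mono Set.subset_union_right
  have range : ψ.range = AddSubgroup.closure (Set.range f ∪ S) := by
    apply le_antisymm
    · rintro _ ⟨⟨n, a, b⟩, rfl⟩
      obtain ⟨a, rfl⟩ := ZMod.intCast_surjective a
      obtain ⟨b, rfl⟩ := ZMod.intCast_surjective b
      rw [hψ, genHom_apply]
      exact add_mem (zsmul_mem (AddSubgroup.subset_closure (Set.mem_union_left _ hPf)) n)
        (add_mem (zsmul_mem (le hTc) a) (zsmul_mem (le hUc) b))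
    · rw [AddSubgroup.closure_le]
      rintro Q (⟨i, rfl⟩ | hQ)
      · obtain ⟨a, ha⟩ := hf i
        exact ⟨(s i, (a : ZMod 4), ((0 : ℤ) : ZMod 2)), by rw [hψ, genHom_apply, ha]; simp⟩
      · obtain ⟨a, b, rfl⟩ := hS Q hQ
        exact ⟨((0 : ℤ), (a : ZMod 4), (b : ZMod 2)), by rw [hψ, genHom_apply]; simp⟩
  constructor
  · rw [← range]
    refine ⟨(AddMonoidHom.ofInjective inj).symm, fun i h => ?_⟩
    obtain ⟨a, ha⟩ := hf i
    have : (AddMonoidHom.ofInjective inj) (s i, (a : ZMod 4), ((0 : ℤ) : ZMod 2)) = ⟨f i, h⟩ := by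
      apply Subtype.ext
      refine (AddMonoidHom.ofInjective_apply inj).trans ?_
      change _ = f i
      rw [hψ, genHom_apply, ha]
      simp
    rw [← this, AddEquiv.symm_apply_apply]
  · intro Q
    constructor
    · rintro ⟨hQ, hfin⟩
      rw [← range] at hQ
      obtain ⟨⟨n, a, b⟩, rfl⟩ := hQ
      obtain ⟨a, rfl⟩ := ZMod.intCast_surjective a
      obtain ⟨b, rfl⟩ := ZMod.intCast_surjective b
      -- Torsion can be tested in ℤ × ℤ/4 × ℤ/2, where it means that the ℤ-component vanishes.
      have h1 : IsOfFinAddOrder ((n, (a : ZMod 4), (b : ZMod 2)) : ℤ × ZMod 4 × ZMod 2) :=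
        (inj.isOfFinAddOrder_iff (f := ψ)).1 hfin
      have h2 : IsOfFinAddOrder n := h1.fst
      have hn : n = 0 := by
        obtain ⟨m, hm, h⟩ := isOfFinAddOrder_iff_nsmul_eq_zero.1 h2
        rcases smul_eq_zero.1 h with h | h
        · omega
        · exact h
      rw [hψ, genHom_apply, hn, zero_smul, zero_add]
      exact add_mem (zsmul_mem hTc a) (zsmul_mem hUc b)
    · intro hQ
      refine ⟨le hQ, ?_⟩
      refine AddSubgroup.closure_induction (p := fun x _ => IsOfFinAddOrder x) ?_ ?_ ?_ ?_ hQ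
      · intro Q hQ
        obtain ⟨a, b, rfl⟩ := hS Q hQ
        refine isOfFinAddOrder_iff_nsmul_eq_zero.2 ⟨4, by norm_num, ?_⟩
        rw [smul_add, smul_comm 4 a T, hT, smul_comm 4 b U, show 4 = 2 * 2 from rfl, mul_smul 2 2 U,
          hU]
        simp
      · exact IsOfFinAddOrder.zero
      · exact fun x y _ _ hx hy => hx.add hy
      · exact fun x _ hx => hx.neg

end Group

/-! ### Walks in the hypercube -/

theorem walkEnd_append (v : Vertex) (l l' : List (Fin 5)) :
    walkEnd v (l ++ l') = walkEnd (walkEnd v l) l' := by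
  simp [walkEnd, List.foldl_append]

/-- The coordinates of the end of a walk count the edges of each color. -/
theorem walkEnd_apply (v : Vertex) (l : List (Fin 5)) (c : Fin 5) :
    walkEnd v l c = v c + (l.count c : ZMod 2) := by
  induction l generalizing v with
  | nil => simp [walkEnd]
  | cons a l ih =>
    have : walkEnd v (a :: l) = walkEnd (step v a) l := rfl
    rw [this, ih, step, Pi.add_apply, List.count_cons]
    by_cases h : a = c
    · subst h
      simp
      ring
    · simp [h]

theorem exists_walkEnd_eq (v w : Vertex) : ∃ l, walkEnd v l = w := by
  refine ⟨(Finset.univ.filter fun c => w c - v c = 1).toList, ?_⟩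
  funext c
  rw [walkEnd_apply, (Finset.nodup_toList _).count]
  have : ∀ a b : ZMod 2, a + (((if b - a = 1 then 1 else 0 : ℕ)) : ZMod 2) = b := by decide
  simpa using this (v c) (w c)

/-- Each edge flips one coordinate, so the parity is visible in the two coordinates `ρ k` and `ρ (k
+ 2)` of the end points. Hence it does not depend on the path, and the color splitting never takes
the value 0. -/
theorem even_splitCount_iff (ρ : Rainbow) (k : Fin 5) (v : Vertex) (l : List (Fin 5)) :
    Even (splitCount ρ k l) ↔
      (walkEnd v l (ρ k) - v (ρ k)) + (walkEnd v l (ρ (k + 2)) - v (ρ (k + 2))) = 0 := by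
  have hne : ρ k ≠ ρ (k + 2) := by
    intro h
    have := ρ.injective h
    clear h
    revert k
    decide
  have : splitCount ρ k l = l.count (ρ k) + l.count (ρ (k + 2)) := by
    unfold splitCount
    induction l with
    | nil => rfl
    | cons a l ih =>
      rw [List.countP_cons, ih, List.count_cons, List.count_cons]
      by_cases h1 : a = ρ k
      · have : a ≠ ρ (k + 2) := h1 ▸ hne
        simp [h1, hne]
        omega
      · by_cases h2 : a = ρ (k + 2)
        · simp [h2, hne.symm]
          omega
        · simp [h1, h2]
  rw [walkEnd_apply, walkEnd_apply, this, ← ZMod.natCast_eq_zero_iff_even]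
  push_cast
  constructor <;> intro h <;> linear_combination h

/-- The color splitting may be read off from any path. -/
theorem colorSplit_walkEnd (ρ : Rainbow) (k : Fin 5) (v : Vertex) (l : List (Fin 5)) :
    colorSplit ρ k v (walkEnd v l) = (-1) ^ splitCount ρ k l := by
  unfold colorSplit
  rcases Nat.even_or_odd (splitCount ρ k l) with h | h
  · rw [if_pos, h.neg_one_pow]
    intro l' hl'
    rw [even_splitCount_iff ρ k v, hl', ← even_splitCount_iff]
    exact h
  · rw [if_neg, if_pos, h.neg_one_pow]
    · intro l' hl'
      rw [← Nat.not_even_iff_odd] at h ⊢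
      rwa [even_splitCount_iff ρ k v, hl', ← even_splitCount_iff]
    · intro h'
      exact (Nat.not_even_iff_odd.2 h) (h' l rfl)

/-- The class in the bipartition is the parity of the length of any path. -/
theorem bipartiteSign_walkEnd (v : Vertex) (l : List (Fin 5)) :
    bipartiteSign v (walkEnd v l) = (-1) ^ l.length := by
  unfold bipartiteSign
  -- In `ZMod 2` a coordinate differs exactly when it was flipped an odd number of times, and the
  -- numbers of flips add up to the length.
  have hc : (((Finset.univ.filter fun c => v c ≠ walkEnd v l c).card : ℕ) : ZMod 2) =
      (l.length : ZMod 2) := by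
    have h1 : ∀ a b : ZMod 2, (((if a ≠ b then 1 else 0 : ℕ)) : ZMod 2) = b - a := by decide
    have h2 : l.length = ∑ c, l.count c := by
      rw [← Multiset.coe_card, ← Multiset.toFinset_sum_count_eq]
      refine (Finset.sum_subset (Finset.subset_univ _) ?_).trans ?_
      · intro x _ hx
        exact Multiset.count_eq_zero.2 (by simpa using hx)
      · simp
    rw [Finset.card_filter, Nat.cast_sum, h2, Nat.cast_sum]
    refine Finset.sum_congr rfl fun c _ => ?_
    rw [h1, walkEnd_apply]
    ring
  rcases Nat.even_or_odd l.length with h | h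
  · rw [h.neg_one_pow, Even.neg_one_pow]
    rw [← ZMod.natCast_eq_zero_iff_even, hc, ZMod.natCast_eq_zero_iff_even]
    exact h
  · rw [h.neg_one_pow, Odd.neg_one_pow]
    rw [← ZMod.natCast_eq_one_iff_odd, hc, ZMod.natCast_eq_one_iff_odd]
    exact h

/-! ### The tenth root of unity -/

theorem zeta_pow_five : zeta ^ 5 = -1 := by
  rw [zeta, ← Complex.exp_nat_mul, ← Complex.exp_pi_mul_I]
  congr 1
  push_cast
  ring

theorem zeta_ne_zero : zeta ≠ 0 := Complex.exp_ne_zero _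

theorem zeta_mul_neg_pow : zeta * -zeta ^ 4 = 1 := by linear_combination -zeta_pow_five

theorem zeta_inv : zeta⁻¹ = -zeta ^ 4 :=
  inv_eq_of_mul_eq_one_right zeta_mul_neg_pow

theorem phi_eq_sub : phi = zeta - zeta ^ 4 := by rw [phi_eq, zeta_inv]; ring

/-- The tenth cyclotomic polynomial, obtained by substituting φ = ζ - ζ⁴ into φ² = φ + 1. The later
`grind` calls on powers of ζ are computations modulo this relation. -/
theorem zeta_poly : zeta ^ 4 - zeta ^ 3 + zeta ^ 2 - zeta + 1 = 0 := by
  have h := phi_sq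
  rw [phi_eq_sub] at h
  linear_combination h - (zeta ^ 3 - 2) * zeta_pow_five

theorem zeta_pow_ten : zeta ^ 10 = 1 := by
  linear_combination (zeta ^ 5 - 1) * zeta_pow_five

theorem zeta_pow_mod (n : ℕ) : zeta ^ n = zeta ^ (n % 10) := by
  conv_lhs => rw [← Nat.div_add_mod n 10, pow_add, pow_mul, zeta_pow_ten, one_pow, one_mul]

theorem phi_ne_zero : phi ≠ 0 := by
  intro h
  have := phi_sq
  rw [h] at this
  norm_num at this

theorem zeta_sq_ne_one : zeta ^ 2 ≠ 1 := by
  intro h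
  have h5 := zeta_pow_five
  have hz : zeta = -1 := by linear_combination h5 - (zeta ^ 3 + zeta) * h
  have h4 := zeta_poly
  rw [hz] at h4
  norm_num at h4

theorem etaConst_eq : etaConst = phi * zeta ^ 4 := by
  have h1 : zeta - zeta ^ 3 ≠ 0 := by
    intro h
    have : zeta * (1 - zeta ^ 2) = 0 := by linear_combination h
    rcases mul_eq_zero.1 this with h | h
    · exact zeta_ne_zero h
    · exact zeta_sq_ne_one (by linear_combination -h)
  rw [etaConst, zeta_inv, phi_eq_sub, div_eq_iff h1]
  have := zeta_poly
  grind

/-! ### Homogeneous coordinates -/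

theorem curveEq_smul {a : ℂ} {x : Fin 5 → ℂ} (h : CurveEq x) : CurveEq (a • x) := by
  obtain ⟨h3, h4, h5⟩ := h
  simp only [CurveEq, Pi.smul_apply, smul_eq_mul]
  refine ⟨?_, ?_, ?_⟩
  · linear_combination a ^ 2 * h3
  · linear_combination a ^ 2 * h4
  · linear_combination a ^ 2 * h5

/-- The point of the curve with given homogeneous coordinates. -/
def Curve.mk (x : Fin 5 → ℂ) (hx : x ≠ 0) (h : CurveEq x) : Curve :=
  ⟨Projectivization.mk ℂ x hx, by
    obtain ⟨a, ha⟩ := Projectivization.exists_smul_eq_mk_rep ℂ x hx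
    rw [← ha]
    exact curveEq_smul h⟩

theorem Curve.exists_coord_mk (x : Fin 5 → ℂ) (hx : x ≠ 0) (h : CurveEq x) :
    ∃ a : ℂ, a ≠ 0 ∧ (Curve.mk x hx h).coord = a • x := by
  obtain ⟨a, ha⟩ := Projectivization.exists_smul_eq_mk_rep ℂ x hx
  exact ⟨a, a.ne_zero, ha.symm⟩

theorem Curve.coord_ne_zero (p : Curve) : p.coord ≠ 0 := p.1.rep_nonzero

theorem Curve.curveEq (p : Curve) : CurveEq p.coord := p.2

theorem Curve.eq_of_coord {p q : Curve} {a : ℂ} (h : p.coord = a • q.coord) : p = q := by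
  apply Subtype.ext
  rw [← p.1.mk_rep, ← q.1.mk_rep, Projectivization.mk_eq_mk_iff']
  exact ⟨a, h.symm⟩

theorem proj_mk (x : Fin 5 → ℂ) (hx : x ≠ 0) (h : CurveEq x) :
    proj (Curve.mk x hx h) =
      if x 1 = 0 then OnePoint.infty else ((x 2 ^ 2 / x 1 ^ 2 : ℂ) : OnePoint ℂ) := by
  obtain ⟨a, ha, e⟩ := Curve.exists_coord_mk x hx h
  simp only [proj, e, Pi.smul_apply, smul_eq_mul, mul_eq_zero, ha, false_or, mul_pow]
  rw [mul_div_mul_left _ _ (pow_ne_zero 2 ha)]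

/-- The projection to the projective line is surjective. -/
theorem proj_surjective : Function.Surjective proj := by
  intro z
  induction z using OnePoint.rec with
  | infty =>
    have h : CurveEq ![Complex.I, 0, 1, Complex.I, Complex.I] := by
      simp only [CurveEq]
      change (0 : ℂ) ^ 2 + 1 ^ 2 + Complex.I ^ 2 = 0 ∧ phi * 0 ^ 2 + 1 ^ 2 + Complex.I ^ 2 = 0 ∧
        (1 + phi) * 0 ^ 2 + 1 ^ 2 + Complex.I ^ 2 = 0
      rw [Complex.I_sq]
      norm_num
    refine ⟨Curve.mk _ (fun h => ?_) h, ?_⟩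
    · have := congrFun h 2
      simp at this
    · rw [proj_mk, if_pos]
      rfl
  | coe z =>
    obtain ⟨a2, h2⟩ := IsAlgClosed.exists_pow_nat_eq z two_pos
    obtain ⟨a3, h3⟩ := IsAlgClosed.exists_pow_nat_eq (-1 - z) two_pos
    obtain ⟨a4, h4⟩ := IsAlgClosed.exists_pow_nat_eq (-phi - z) two_pos
    obtain ⟨a5, h5⟩ := IsAlgClosed.exists_pow_nat_eq (-(1 + phi) - z) two_pos
    have h : CurveEq ![a5, 1, a2, a3, a4] := by
      simp only [CurveEq]
      change (1 : ℂ) ^ 2 + a2 ^ 2 + a3 ^ 2 = 0 ∧ phi * 1 ^ 2 + a2 ^ 2 + a4 ^ 2 = 0 ∧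
        (1 + phi) * 1 ^ 2 + a2 ^ 2 + a5 ^ 2 = 0
      rw [h2, h3, h4, h5]
      refine ⟨?_, ?_, ?_⟩ <;> ring
    refine ⟨Curve.mk _ (fun h => ?_) h, ?_⟩
    · have := congrFun h 1
      simp at this
    · rw [proj_mk, if_neg]
      · change ((a2 ^ 2 / 1 ^ 2 : ℂ) : OnePoint ℂ) = _
        rw [h2, one_pow, div_one]
      · exact one_ne_zero

theorem coord_ne_zero_of_proj {p : Curve} {z : ℂ} (h : proj p = (z : OnePoint ℂ)) :
    p.coord 1 ≠ 0 ∧ p.coord 2 ^ 2 = z * p.coord 1 ^ 2 := by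
  unfold proj at h
  split_ifs at h with h1
  · exact absurd h (OnePoint.infty_ne_coe _)
  · refine ⟨h1, ?_⟩
    have := OnePoint.coe_injective h
    rw [← this]
    field_simp

theorem proj_eq_coe {p : Curve} {z : ℂ} (h1 : p.coord 1 ≠ 0)
    (h : p.coord 2 ^ 2 = z * p.coord 1 ^ 2) : proj p = (z : OnePoint ℂ) := by
  unfold proj
  rw [if_neg h1, h, mul_div_assoc, div_self (pow_ne_zero 2 h1), mul_one]

theorem coord_eq_zero_of_proj {p : Curve} (h : proj p = OnePoint.infty) : p.coord 1 = 0 := by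
  unfold proj at h
  split_ifs at h with h1
  · exact h1
  · exact absurd h (OnePoint.coe_ne_infty _)

/-! ### The fibres of π over η(w) -/

theorem eta_infty : eta OnePoint.infty = (etaConst : OnePoint ℂ) := rfl

theorem eta_coe {w : ℂ} (h : w ≠ -zeta ^ 4) :
    eta (w : OnePoint ℂ) = (((w - zeta) / (w + zeta ^ 4) * (phi * zeta ^ 4) : ℂ) : OnePoint ℂ) := by
  change (if w = zeta⁻¹ then OnePoint.infty
    else (((w - zeta) / (w - zeta⁻¹) * etaConst : ℂ) : OnePoint ℂ)) = _
  rw [zeta_inv, if_neg h, etaConst_eq, sub_neg_eq_add]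

theorem eta_coe_pole : eta ((-zeta ^ 4 : ℂ) : OnePoint ℂ) = OnePoint.infty := by
  change (if -zeta ^ 4 = zeta⁻¹ then OnePoint.infty
    else (((-zeta ^ 4 - zeta) / (-zeta ^ 4 - zeta⁻¹) * etaConst : ℂ) : OnePoint ℂ)) = _
  rw [zeta_inv, if_pos rfl]

/-- The squares of the homogeneous coordinates of the points over `η(0)`. -/
def sqCoeff : Fin 5 → ℂ := ![phi * zeta ^ 4, 1, -(phi * zeta), zeta ^ 2, zeta ^ 3]

theorem sqCoeff_ne_zero (i : Fin 5) : sqCoeff i ≠ 0 := by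
  have hz := zeta_ne_zero
  have hp := phi_ne_zero
  fin_cases i <;> simp [sqCoeff, hz, hp]

theorem sqCoeff_one : sqCoeff 1 = 1 := rfl

/-- The lines `α - β ζ^(3 - 2i)` solve the equations of the curve. -/
theorem curveEq_of_sq {x : Fin 5 → ℂ} {α β : ℂ}
    (h : ∀ i : Fin 5, x i ^ 2 = sqCoeff i * (α - β * zeta ^ (13 - 2 * (i : ℕ)))) : CurveEq x := by
  have h5 : x 5 ^ 2 = phi * zeta ^ 4 * (α - β * zeta ^ 13) := h 0
  have h1 : x 1 ^ 2 = 1 * (α - β * zeta ^ 11) := h 1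
  have h2 : x 2 ^ 2 = -(phi * zeta) * (α - β * zeta ^ 9) := h 2
  have h3 : x 3 ^ 2 = zeta ^ 2 * (α - β * zeta ^ 7) := h 3
  have h4 : x 4 ^ 2 = zeta ^ 3 * (α - β * zeta ^ 5) := h 4
  have hz := zeta_poly
  unfold CurveEq
  rw [h1, h2, h3, h4, h5, phi_eq_sub]
  clear h h1 h2 h3 h4 h5
  refine ⟨?_, ?_, ?_⟩ <;> grind

/-- Each x_i² is a linear form in x_1² and x_2², hence in w after clearing the denominator of η,
with its zero at w = ζ^(2i-3). The exponent 13 - 2i stands for 3 - 2i modulo 10 and stays natural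
for i ≤ 4; reading the index 5 as 0 is harmless for the same reason. The factor 1 - wζ is the one
belonging to i = 1. -/
theorem sq_of_curveEq {x : Fin 5 → ℂ} (h : CurveEq x) {w : ℂ}
    (hw : x 2 ^ 2 * (w + zeta ^ 4) = (w - zeta) * (phi * zeta ^ 4) * x 1 ^ 2) (i : Fin 5) :
    x i ^ 2 * (1 - w * zeta) = sqCoeff i * (1 - w * zeta ^ (13 - 2 * (i : ℕ))) * x 1 ^ 2 := by
  obtain ⟨h3, h4, h5⟩ := h
  have h3' : x 3 ^ 2 = -x 1 ^ 2 - x 2 ^ 2 := by linear_combination h3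
  have h4' : x 4 ^ 2 = -phi * x 1 ^ 2 - x 2 ^ 2 := by linear_combination h4
  have h5' : x 5 ^ 2 = -(1 + phi) * x 1 ^ 2 - x 2 ^ 2 := by linear_combination h5
  have hz := zeta_poly
  fin_cases i
  · change x 5 ^ 2 * (1 - w * zeta) = phi * zeta ^ 4 * (1 - w * zeta ^ 13) * x 1 ^ 2
    rw [h5']
    rw [phi_eq_sub] at *
    clear h3 h4 h5 h3' h4' h5'
    generalize x 1 ^ 2 = a, x 2 ^ 2 = b at *
    have g : (-(1 + (zeta - zeta ^ 4)) * a - b) * (1 - w * zeta) -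
        (zeta - zeta ^ 4) * zeta ^ 4 * (1 - w * zeta ^ 13) * a = zeta * (b * (w + zeta ^ 4) -
        (w - zeta) * ((zeta - zeta ^ 4) * zeta ^ 4) * a) := by
      clear hw
      grind
    linear_combination g + zeta * hw
  · change x 1 ^ 2 * (1 - w * zeta) = 1 * (1 - w * zeta ^ 11) * x 1 ^ 2
    linear_combination x 1 ^ 2 * w * zeta * zeta_pow_ten
  · change x 2 ^ 2 * (1 - w * zeta) = -(phi * zeta) * (1 - w * zeta ^ 9) * x 1 ^ 2
    rw [phi_eq_sub] at *
    clear h3 h4 h5 h3' h4' h5'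
    generalize x 1 ^ 2 = a, x 2 ^ 2 = b at *
    have g : b * (1 - w * zeta) + ((zeta - zeta ^ 4) * zeta) * (1 - w * zeta ^ 9) * a =
        -zeta * (b * (w + zeta ^ 4) - (w - zeta) * ((zeta - zeta ^ 4) * zeta ^ 4) * a) := by
      clear hw
      grind
    linear_combination g - zeta * hw
  · change x 3 ^ 2 * (1 - w * zeta) = zeta ^ 2 * (1 - w * zeta ^ 7) * x 1 ^ 2
    rw [h3']
    rw [phi_eq_sub] at *
    clear h3 h4 h5 h3' h4' h5'
    generalize x 1 ^ 2 = a, x 2 ^ 2 = b at *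
    have g : (-a - b) * (1 - w * zeta) - zeta ^ 2 * (1 - w * zeta ^ 7) * a =
        zeta * (b * (w + zeta ^ 4) - (w - zeta) * ((zeta - zeta ^ 4) * zeta ^ 4) * a) := by
      clear hw
      grind
    linear_combination g + zeta * hw
  · change x 4 ^ 2 * (1 - w * zeta) = zeta ^ 3 * (1 - w * zeta ^ 5) * x 1 ^ 2
    rw [h4']
    rw [phi_eq_sub] at *
    clear h3 h4 h5 h3' h4' h5'
    generalize x 1 ^ 2 = a, x 2 ^ 2 = b at *
    have g : (-(zeta - zeta ^ 4) * a - b) * (1 - w * zeta) - zeta ^ 3 * (1 - w * zeta ^ 5) * a =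
        zeta * (b * (w + zeta ^ 4) - (w - zeta) * ((zeta - zeta ^ 4) * zeta ^ 4) * a) := by
      clear hw
      grind
    linear_combination g + zeta * hw

theorem sq_of_proj {p : Curve} {w : ℂ} (hw : w ≠ -zeta ^ 4)
    (h : proj p = eta (w : OnePoint ℂ)) :
    p.coord 1 ≠ 0 ∧ ∀ i : Fin 5, p.coord i ^ 2 * (1 - w * zeta) =
      sqCoeff i * (1 - w * zeta ^ (13 - 2 * (i : ℕ))) * p.coord 1 ^ 2 := by
  rw [eta_coe hw] at h
  obtain ⟨h1, h2⟩ := coord_ne_zero_of_proj h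
  have : w + zeta ^ 4 ≠ 0 := fun h => hw (eq_neg_of_add_eq_zero_left h)
  refine ⟨h1, fun i => sq_of_curveEq p.curveEq ?_ i⟩
  rw [h2]
  field_simp

theorem proj_of_sq {p : Curve} {w : ℂ} (hw : w ≠ -zeta ^ 4) (h1 : p.coord 1 ≠ 0)
    (h2 : p.coord 2 ^ 2 * (1 - w * zeta) = sqCoeff 2 * (1 - w * zeta ^ 9) * p.coord 1 ^ 2) :
    proj p = eta (w : OnePoint ℂ) := by
  rw [eta_coe hw]
  have : w + zeta ^ 4 ≠ 0 := fun h => hw (eq_neg_of_add_eq_zero_left h)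
  refine proj_eq_coe h1 ?_
  field_simp
  have h2' : p.coord 2 ^ 2 * (1 - w * zeta) = -(phi * zeta) * (1 - w * zeta ^ 9) * p.coord 1 ^ 2 :=
    h2
  linear_combination zeta ^ 4 * h2' + (w * p.coord 2 ^ 2 - phi * zeta ^ 4 * p.coord 1 ^ 2 * w *
    (1 - zeta ^ 5)) * zeta_pow_five

theorem mem_blackPoints {p : Curve} :
    p ∈ blackPoints ↔ p.coord 1 ≠ 0 ∧ ∀ i, p.coord i ^ 2 = sqCoeff i * p.coord 1 ^ 2 := by
  have hz : (0 : ℂ) ≠ -zeta ^ 4 := (neg_ne_zero.2 (pow_ne_zero 4 zeta_ne_zero)).symm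
  constructor
  · intro h
    simpa using sq_of_proj hz h
  · rintro ⟨h1, h⟩
    exact proj_of_sq hz h1 (by simpa using h 2)

/-- At w = ∞ only the leading coefficients in w survive: c_i ζ^(13-2i), divided by the factor ζ^11
of i = 1. -/
theorem mem_whitePoints {p : Curve} :
    p ∈ whitePoints ↔ p.coord 1 ≠ 0 ∧
      ∀ i : Fin 5, p.coord i ^ 2 = sqCoeff i * zeta ^ (12 - 2 * (i : ℕ)) * p.coord 1 ^ 2 := by
  change proj p = eta OnePoint.infty ↔ _
  rw [eta_infty, etaConst_eq]
  constructor
  · intro h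
    obtain ⟨h1, h2⟩ := coord_ne_zero_of_proj h
    obtain ⟨h3, h4, h5⟩ := p.curveEq
    refine ⟨h1, fun i => ?_⟩
    have hz := zeta_poly
    fin_cases i
    · change p.coord 5 ^ 2 = phi * zeta ^ 4 * zeta ^ 12 * p.coord 1 ^ 2
      have g : -(1 + phi) - phi * zeta ^ 4 = phi * zeta ^ 4 * zeta ^ 12 := by
        rw [phi_eq_sub]
        grind
      linear_combination h5 - h2 + p.coord 1 ^ 2 * g
    · change p.coord 1 ^ 2 = 1 * zeta ^ 10 * p.coord 1 ^ 2
      rw [zeta_pow_ten, one_mul, one_mul]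
    · change p.coord 2 ^ 2 = -(phi * zeta) * zeta ^ 8 * p.coord 1 ^ 2
      linear_combination h2 + phi * zeta ^ 4 * p.coord 1 ^ 2 * zeta_pow_five
    · change p.coord 3 ^ 2 = zeta ^ 2 * zeta ^ 6 * p.coord 1 ^ 2
      have g : -1 - phi * zeta ^ 4 = zeta ^ 2 * zeta ^ 6 := by
        rw [phi_eq_sub]
        grind
      linear_combination h3 - h2 + p.coord 1 ^ 2 * g
    · change p.coord 4 ^ 2 = zeta ^ 3 * zeta ^ 4 * p.coord 1 ^ 2
      have g : -phi - phi * zeta ^ 4 = zeta ^ 3 * zeta ^ 4 := by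
        rw [phi_eq_sub]
        grind
      linear_combination h4 - h2 + p.coord 1 ^ 2 * g
  · rintro ⟨h1, h⟩
    refine proj_eq_coe h1 ?_
    have h2 : p.coord 2 ^ 2 = -(phi * zeta) * zeta ^ 8 * p.coord 1 ^ 2 := h 2
    linear_combination h2 - phi * zeta ^ 4 * p.coord 1 ^ 2 * zeta_pow_five

/-- For w = ζ^(2j+1) the factor 1 - w ζ^(13-2i) vanishes at i = j + 2, because the exponents add up
to a multiple of 10. -/
theorem coord_eq_zero_of_mem_faceCenters {j : Fin 5} {f : Curve} (h : f ∈ faceCenters j) :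
    f.coord (j + 2) = 0 := by
  have h9 : zeta ^ 9 = -zeta ^ 4 := by linear_combination zeta ^ 4 * zeta_pow_five
  -- Here w = ζ^9 = ζ⁻¹ is the pole of η, so the point lies over ∞, where coordinate 1 vanishes.
  by_cases hj : j = 4
  · subst hj
    have h' : proj f = eta ((zeta ^ 9 : ℂ) : OnePoint ℂ) := h
    rw [h9, eta_coe_pole] at h'
    exact coord_eq_zero_of_proj h'
  · have hlt : (j : ℕ) < 4 := by
      have := j.2
      have : (j : ℕ) ≠ 4 := fun h => hj (Fin.ext h)
      omega
    have ne : ∀ n : ℕ, n < 4 → zeta ^ (2 * n + 1) ≠ zeta ^ 9 ∧ 1 - zeta ^ (2 * n + 1) * zeta ≠ 0 := by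
      intro n hn
      have hz := zeta_poly
      interval_cases n <;> constructor <;> intro h <;> grind
    have hw : zeta ^ (2 * (j : ℕ) + 1) ≠ -zeta ^ 4 := h9 ▸ (ne j hlt).1
    have := (sq_of_proj hw h).2 (j + 2)
    have e : zeta ^ (2 * (j : ℕ) + 1) * zeta ^ (13 - 2 * ((j + 2 : Fin 5) : ℕ)) = 1 := by
      rw [← pow_add, zeta_pow_mod]
      have : (2 * (j : ℕ) + 1 + (13 - 2 * ((j + 2 : Fin 5) : ℕ))) % 10 = 0 := by
        clear * -
        revert j
        decide
      rw [this, pow_zero]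
    rw [e, sub_self, mul_zero, zero_mul] at this
    have := (mul_eq_zero.1 this).resolve_right (ne j hlt).2
    exact pow_eq_zero_iff two_ne_zero |>.1 this

theorem faceCenters_nonempty (j : Fin 5) : (faceCenters j).Nonempty := proj_surjective _

/-! ### Continuity on the curve -/

theorem continuous_curve_mk {Y : Type*} [TopologicalSpace Y] {x : Y → Fin 5 → ℂ}
    (hx : Continuous x) (h0 : ∀ t, x t ≠ 0) (h : ∀ t, CurveEq (x t)) :
    Continuous fun t => Curve.mk (x t) (h0 t) (h t) := by
  have h1 : Continuous fun t => (⟨x t, h0 t⟩ : {v : Fin 5 → ℂ // v ≠ 0}) := hx.subtype_mk h0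
  have h2 : Continuous fun t => Projectivization.mk ℂ (x t) (h0 t) :=
    (continuous_quotient_mk' (s := projectivizationSetoid ℂ (Fin 5 → ℂ))).comp h1
  exact h2.subtype_mk _

/-- The representative chosen by `rep` need not vary continuously, but ratios of coordinates do not
depend on it, so openness of preimages can be tested on the space of nonzero vectors. -/
theorem continuousOn_coord_div (i : Fin 5) :
    ContinuousOn (fun p : Curve => p.coord i / p.coord 1) {p | p.coord 1 ≠ 0} := by
  have key : ∀ V : Set ℂ, IsOpen V →
      IsOpen {p : Curve | p.coord 1 ≠ 0 ∧ p.coord i / p.coord 1 ∈ V} := by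
    intro V hV
    have h1 : IsOpen {P : ℙ ℂ (Fin 5 → ℂ) | P.rep 1 ≠ 0 ∧ P.rep i / P.rep 1 ∈ V} := by
      refine (isQuotientMap_quotient_mk'
        (s := projectivizationSetoid ℂ (Fin 5 → ℂ))).isOpen_preimage.1 ?_
      have : (fun v : {v : Fin 5 → ℂ // v ≠ 0} =>
          (Projectivization.mk ℂ v.1 v.2 : ℙ ℂ (Fin 5 → ℂ))) ⁻¹'
            {P | P.rep 1 ≠ 0 ∧ P.rep i / P.rep 1 ∈ V} =
          {v | v.1 1 ≠ 0 ∧ v.1 i / v.1 1 ∈ V} := by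
        ext ⟨v, hv⟩
        obtain ⟨a, ha⟩ := Projectivization.exists_smul_eq_mk_rep ℂ v hv
        have ha' : (Projectivization.mk ℂ v hv).rep = (a : ℂ) • v := ha.symm
        simp only [Set.mem_preimage, Set.mem_ofPred_eq, ha', Pi.smul_apply, smul_eq_mul, ne_eq,
          mul_eq_zero, a.ne_zero, false_or]
        rw [mul_div_mul_left _ _ a.ne_zero]
      refine (congrArg IsOpen this).mpr ?_
      have c : ∀ j, Continuous fun v : {v : Fin 5 → ℂ // v ≠ 0} => v.1 j := fun j =>
        (continuous_apply j).comp continuous_subtype_val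
      have hU : IsOpen {v : {v : Fin 5 → ℂ // v ≠ 0} | v.1 1 ≠ 0} :=
        isOpen_ne_fun (c 1) continuous_const
      have hc : ContinuousOn (fun v : {v : Fin 5 → ℂ // v ≠ 0} => v.1 i / v.1 1)
          {v | v.1 1 ≠ 0} :=
        (c i).continuousOn.div (c 1).continuousOn fun v hv => hv
      exact hc.isOpen_inter_preimage hU hV
    exact h1.preimage continuous_subtype_val
  intro p hp
  refine ContinuousAt.continuousWithinAt ?_
  rw [ContinuousAt, Filter.tendsto_def]
  intro V hV
  obtain ⟨V', hV', ho, hm⟩ := mem_nhds_iff.1 hV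
  exact Filter.mem_of_superset ((key V' ho).mem_nhds ⟨hp, hm⟩) fun q hq => hV' hq.2

/-! ### Square roots along the edges -/

/-- The factor of the square of the `i`-th coordinate at the parameter `s` of the edges of color
`j`. -/
def edgeSq (j i : Fin 5) (s : ℂ) : ℂ := (1 - s) - s * zeta ^ (2 * (j : ℕ) + (13 - 2 * (i : ℕ)))

/-- The factor of the `i`-th coordinate at the parameter `s` of the edges of color `j`. -/
def edgeRoot (j i : Fin 5) (s : ℂ) : ℂ := edgeSq j i s ^ (2⁻¹ : ℂ)

/-- The exponent of `ζ` in the ratio of the `i`-th coordinates of the ends of the edges of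
color `j`. -/
def edgeExp (j i : Fin 5) : ℕ :=
  if ((j : ℕ) + 4 - i) % 5 ≤ 2 then ((j : ℕ) + 4 - i) % 5 else ((j : ℕ) + 4 - i) % 5 + 5

theorem odd_zeta_pow_five (j i : Fin 5) :
    (zeta ^ (2 * (j : ℕ) + (13 - 2 * (i : ℕ)))) ^ 5 = -1 := by
  have : Odd (2 * (j : ℕ) + (13 - 2 * (i : ℕ))) := by
    revert i j
    decide
  rw [← pow_mul, mul_comm, pow_mul, zeta_pow_five, this.neg_one_pow]

/-- With u the odd power of ζ, the line through 1 and -u meets the real axis only at 1 unless u is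
real. A real u with u⁵ = -1 is -1, and then the line degenerates to the point 1. -/
theorem edgeSq_mem_slitPlane (j i : Fin 5) (t : ℝ) :
    edgeSq j i t ∈ Complex.slitPlane := by
  have h5 := odd_zeta_pow_five j i
  unfold edgeSq
  set u := zeta ^ (2 * (j : ℕ) + (13 - 2 * (i : ℕ))) with hu
  rw [Complex.mem_slitPlane_iff]
  have re : ((1 - t : ℂ) - t * u).re = 1 - t - t * u.re := by simp
  have im : ((1 - t : ℂ) - t * u).im = -(t * u.im) := by simp
  rw [re, im, or_iff_not_imp_right, not_not, neg_eq_zero, mul_eq_zero]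
  rintro (h | h)
  · simp [h]
  · have hr : u = (u.re : ℂ) := Complex.ext rfl (by simpa using h)
    have h5' : u.re ^ 5 = (-1) ^ 5 := by
      rw [hr] at h5
      have : u.re ^ 5 = -1 := by exact_mod_cast h5
      rw [this]
      norm_num
    rw [(Odd.strictMono_pow (⟨2, rfl⟩ : Odd 5)).injective h5']
    norm_num

theorem edgeSq_ne_zero (j i : Fin 5) (t : ℝ) : edgeSq j i t ≠ 0 :=
  Complex.slitPlane_ne_zero (edgeSq_mem_slitPlane j i t)

theorem edgeRoot_sq (j i : Fin 5) (s : ℂ) : edgeRoot j i s ^ 2 = edgeSq j i s := by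
  have := Complex.cpow_nat_inv_pow (edgeSq j i s) two_ne_zero
  exact_mod_cast this

theorem edgeRoot_ne_zero (j i : Fin 5) (t : ℝ) :
    edgeRoot j i t ≠ 0 := by
  intro h
  have := edgeRoot_sq j i t
  rw [h, zero_pow two_ne_zero] at this
  exact edgeSq_ne_zero j i t this.symm

theorem continuousAt_edgeRoot (j i : Fin 5) (t : ℝ) :
    ContinuousAt (edgeRoot j i) t := by
  have h1 : ContinuousAt (edgeSq j i) t := by
    unfold edgeSq
    fun_prop
  exact (continuousAt_cpow_const (edgeSq_mem_slitPlane j i t)).comp h1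

theorem edgeRoot_zero (j i : Fin 5) : edgeRoot j i 0 = 1 := by
  simp [edgeRoot, edgeSq]

theorem zeta_pow_re (n : ℕ) : (zeta ^ n).re = Real.cos (n * Real.pi / 5) := by
  rw [zeta, ← Complex.exp_nat_mul,
    show (n : ℂ) * (2 * Real.pi * Complex.I / 10) = ((n * Real.pi / 5 : ℝ) : ℂ) * Complex.I by
      push_cast; ring, Complex.exp_ofReal_mul_I_re]

theorem zeta_pow_edgeExp_re_pos (j i : Fin 5) : 0 < (zeta ^ edgeExp j i).re := by
  have hpi := Real.pi_pos
  have small : ∀ n : ℕ, n ≤ 2 → 0 < (zeta ^ n).re := by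
    intro n hn
    have hn' : (n : ℝ) ≤ 2 := by exact_mod_cast hn
    have hn0 : (0 : ℝ) ≤ n := Nat.cast_nonneg n
    rw [zeta_pow_re]
    apply Real.cos_pos_of_mem_Ioo
    constructor <;> nlinarith
  have large : ∀ n : ℕ, 8 ≤ n → n ≤ 9 → 0 < (zeta ^ n).re := by
    intro n hn hn9
    have hn' : (n : ℝ) ≤ 9 := by exact_mod_cast hn9
    have hn0 : (8 : ℝ) ≤ n := by exact_mod_cast hn
    rw [zeta_pow_re, ← Real.cos_sub_two_pi]
    apply Real.cos_pos_of_mem_Ioo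
    constructor <;> nlinarith
  have : edgeExp j i ≤ 2 ∨ 8 ≤ edgeExp j i ∧ edgeExp j i ≤ 9 := by
    revert i j
    decide
  rcases this with h | ⟨h, h'⟩
  · exact small _ h
  · exact large _ h h'

/-- The factor at the white end is -ζ^(2j+13-2i) = ζ^(2(j+4-i)), and the principal root is the one
with positive real part. Hence the representatives 0, 1, 2, 8, 9 in `edgeExp`. -/
theorem edgeRoot_one (j i : Fin 5) : edgeRoot j i 1 = zeta ^ edgeExp j i := by
  have : edgeSq j i 1 = (zeta ^ edgeExp j i) ^ 2 := by
    rw [edgeSq, ← pow_mul, sub_self, one_mul, zero_sub, neg_eq_neg_one_mul, ← zeta_pow_five,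
      ← pow_add, zeta_pow_mod, zeta_pow_mod (edgeExp j i * 2)]
    congr 1
    revert i j
    decide
  rw [edgeRoot, this, Complex.sq_cpow_two_inv (zeta_pow_edgeExp_re_pos j i)]

/-! ### The edges on the curve -/

theorem ray_ne {t : ℝ} (ht : 0 < t) (j : Fin 5) : (t : ℂ) * zeta ^ (2 * (j : ℕ)) ≠ -zeta ^ 4 := by
  intro h
  have h5 := congrArg (· ^ 5) h
  have e1 : ((t : ℂ) * zeta ^ (2 * (j : ℕ))) ^ 5 = (t : ℂ) ^ 5 := by
    rw [mul_pow, ← pow_mul, mul_comm (2 * (j : ℕ)) 5, ← mul_assoc, pow_mul, pow_mul zeta 5 2,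
      zeta_pow_five]
    norm_num
  have e2 : (-zeta ^ 4) ^ 5 = -1 := by
    linear_combination (-zeta ^ 15 + zeta ^ 10 - zeta ^ 5 + 1) * zeta_pow_five
  simp only [e1, e2] at h5
  have h6 : t ^ 5 = -1 := by exact_mod_cast h5
  have := pow_pos ht 5
  linarith

/-- The points over the closure of the path of color `j`, with the parameter `t` of the path. -/
def OverEdge (j : Fin 5) (t : ℝ) (p : Curve) : Prop :=
  p.coord 1 ≠ 0 ∧
    ∀ i, p.coord i ^ 2 * edgeSq j 1 t = sqCoeff i * edgeSq j i t * p.coord 1 ^ 2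

theorem overEdge_zero {p : Curve} (h : p ∈ blackPoints) (j : Fin 5) : OverEdge j 0 p := by
  obtain ⟨h1, h2⟩ := mem_blackPoints.1 h
  refine ⟨h1, fun i => ?_⟩
  simp [edgeSq, h2 i]

theorem overEdge_one {p : Curve} (h : p ∈ whitePoints) (j : Fin 5) : OverEdge j 1 p := by
  obtain ⟨h1, h2⟩ := mem_whitePoints.1 h
  refine ⟨h1, fun i => ?_⟩
  have e : zeta ^ (12 - 2 * (i : ℕ)) * zeta ^ (2 * (j : ℕ) + (13 - 2 * ((1 : Fin 5) : ℕ))) =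
      zeta ^ (2 * (j : ℕ) + (13 - 2 * (i : ℕ))) := by
    rw [← pow_add, zeta_pow_mod, zeta_pow_mod (2 * (j : ℕ) + (13 - 2 * (i : ℕ)))]
    congr 1
    clear * -
    revert i j
    decide
  simp only [edgeSq, Complex.ofReal_one, sub_self, zero_sub, one_mul, h2 i]
  linear_combination -sqCoeff i * p.coord 1 ^ 2 * e

theorem exists_overEdge {p : Curve} {j : Fin 5} (h : proj p ∈ gamma j) :
    ∃ t ∈ Set.Icc (0 : ℝ) 1, OverEdge j t p := by
  obtain ⟨t, ht, h⟩ := h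
  obtain ⟨h1, h2⟩ := sq_of_proj (ray_ne ht j) h
  have h1t : (0 : ℝ) < 1 + t := by linarith
  -- This reparametrization turns the ray 0 < t < ∞ into the interval (0, 1), so that the white end
  -- becomes the finite parameter 1.
  refine ⟨t / (1 + t), ⟨by positivity, (div_le_one h1t).2 (by linarith)⟩, h1, fun i => ?_⟩
  have ht' : (1 + t : ℂ) ≠ 0 := by exact_mod_cast h1t.ne'
  have e : ∀ i : Fin 5, edgeSq j i ((t / (1 + t) : ℝ) : ℂ) =
      (1 - t * zeta ^ (2 * (j : ℕ)) * zeta ^ (13 - 2 * (i : ℕ))) / (1 + t) := by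
    intro i
    rw [edgeSq, pow_add]
    push_cast
    field_simp
    ring
  have e1 : zeta ^ (13 - 2 * ((1 : Fin 5) : ℕ)) = zeta := by
    change zeta ^ 11 = zeta
    linear_combination zeta * zeta_pow_ten
  rw [e, e, e1]
  linear_combination (h2 i) / (1 + t)

/-- The parameter of a point over the closure of the path of color `j`. -/
def edgePar (j : Fin 5) (p : Curve) : ℂ :=
  ((p.coord 2 / p.coord 1) ^ 2 - sqCoeff 2) /
    (((p.coord 2 / p.coord 1) ^ 2 - sqCoeff 2) + zeta ^ (2 * (j : ℕ)) *
      ((p.coord 2 / p.coord 1) ^ 2 * zeta - sqCoeff 2 * zeta ^ 9))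

theorem edgePar_denom_ne_zero {j : Fin 5} {t : ℝ} {p : Curve} (h : OverEdge j t p) :
    ((p.coord 2 / p.coord 1) ^ 2 - sqCoeff 2) + zeta ^ (2 * (j : ℕ)) *
      ((p.coord 2 / p.coord 1) ^ 2 * zeta - sqCoeff 2 * zeta ^ 9) ≠ 0 ∧ edgePar j p = t := by
  obtain ⟨h1, h2⟩ := h
  have h2 := h2 2
  unfold edgePar
  have hz : (p.coord 2 / p.coord 1) ^ 2 * edgeSq j 1 t = sqCoeff 2 * edgeSq j 2 t := by
    rw [div_pow, div_mul_eq_mul_div, h2]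
    field_simp
  generalize (p.coord 2 / p.coord 1) ^ 2 = z at *
  have e1 : edgeSq j 1 t = (1 - t) - t * (zeta ^ (2 * (j : ℕ)) * zeta) := by
    rw [edgeSq, pow_add]
    change 1 - (t : ℂ) - t * (zeta ^ (2 * (j : ℕ)) * zeta ^ 11) = _
    linear_combination -t * zeta ^ (2 * (j : ℕ)) * zeta * zeta_pow_ten
  have e2 : edgeSq j 2 t = (1 - t) - t * (zeta ^ (2 * (j : ℕ)) * zeta ^ 9) := by
    rw [edgeSq, pow_add]
    rfl
  rw [e1, e2] at hz
  -- The relation `hz` is linear in t. If its coefficient of t vanished, then z would equal `sqCoeff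
  -- 2`, and ζ^8 would be 1.
  have ne : (z - sqCoeff 2) + zeta ^ (2 * (j : ℕ)) * (z * zeta - sqCoeff 2 * zeta ^ 9) ≠ 0 := by
    intro h0
    have hA : z = sqCoeff 2 := by linear_combination hz + t * h0
    have hB : zeta ^ (2 * (j : ℕ)) * (sqCoeff 2 * zeta * (1 - zeta ^ 8)) = 0 := by
      rw [hA] at h0
      linear_combination h0
    have h8 : 1 - zeta ^ 8 ≠ 0 := by
      intro h8
      apply zeta_sq_ne_one
      linear_combination zeta_pow_ten + zeta ^ 2 * h8
    exact mul_ne_zero (pow_ne_zero _ zeta_ne_zero)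
      (mul_ne_zero (mul_ne_zero (sqCoeff_ne_zero 2) zeta_ne_zero) h8) hB
  refine ⟨ne, ?_⟩
  rw [div_eq_iff ne]
  linear_combination hz

theorem coord_div_sq {j : Fin 5} {t : ℝ} {p : Curve}
    (h : OverEdge j t p) {x : Fin 5 → ℂ} (hx1 : x 1 ≠ 0) (hx : ∀ i, x i ^ 2 = sqCoeff i * x 1 ^ 2)
    (i : Fin 5) :
    (p.coord i / p.coord 1) ^ 2 =
      (x i / x 1 * (edgeRoot j i (edgePar j p) / edgeRoot j 1 (edgePar j p))) ^ 2 := by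
  rw [(edgePar_denom_ne_zero h).2]
  obtain ⟨h1, h2⟩ := h
  have := edgeSq_ne_zero j 1 t
  rw [mul_pow, div_pow, div_pow, div_pow, edgeRoot_sq, edgeRoot_sq, hx i]
  field_simp
  linear_combination h2 i

/-- The coordinates vary along an edge by the square roots `edgeRoot`. -/
theorem exists_sign_of_mem_closure {j : Fin 5} {e : Set Curve} (he : e ∈ edges j) {p q : Curve}
    (hp : p ∈ closure e) (hq : q ∈ closure e) {s t : ℝ} (hs : s ∈ Set.Icc (0 : ℝ) 1)
    (ht : t ∈ Set.Icc (0 : ℝ) 1) (hps : OverEdge j s p) (hqt : OverEdge j t q) (i : Fin 5) :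
    p.coord i / p.coord 1 * (edgeRoot j i t / edgeRoot j 1 t) =
      q.coord i / q.coord 1 * (edgeRoot j i s / edgeRoot j 1 s) := by
  obtain ⟨p0, hp0, rfl⟩ := he
  set e := connectedComponentIn (proj ⁻¹' gamma j) p0 with he
  -- Adjoining points of the closure keeps the component preconnected, so the ends can be compared
  -- with the interior.
  have hpre : IsPreconnected (insert p (insert q e)) := by
    refine isPreconnected_connectedComponentIn.subset_closure
      (fun x hx => Set.mem_insert_of_mem _ (Set.mem_insert_of_mem _ hx)) ?_
    rintro x (rfl | rfl | hx)
    · exact hp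
    · exact hq
    · exact subset_closure hx
  set S := insert p (insert q e) with hS
  have hover : ∀ x ∈ S, ∃ t ∈ Set.Icc (0 : ℝ) 1, OverEdge j t x := by
    rintro x (rfl | rfl | hx)
    · exact ⟨s, hs, hps⟩
    · exact ⟨t, ht, hqt⟩
    · exact exists_overEdge (connectedComponentIn_subset (proj ⁻¹' gamma j) p0 hx)
  -- An auxiliary black vector, used only as a reference lift; the sign between it and the actual
  -- edge cancels at the end.
  obtain ⟨x, hx1, hx⟩ : ∃ x : Fin 5 → ℂ, x 1 ≠ 0 ∧ ∀ i, x i ^ 2 = sqCoeff i * x 1 ^ 2 := by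
    choose x hx using fun i => IsAlgClosed.exists_pow_nat_eq (sqCoeff i) two_pos
    have h1 : x 1 ^ 2 = 1 := (hx 1).trans sqCoeff_one
    refine ⟨x, fun h => ?_, fun i => ?_⟩
    · rw [h] at h1
      norm_num at h1
    · rw [h1, hx, mul_one]
  have ne : ∀ i, x i ≠ 0 := by
    intro i hi
    have := hx i
    rw [hi, zero_pow two_ne_zero] at this
    exact mul_ne_zero (sqCoeff_ne_zero i) (pow_ne_zero 2 hx1) this.symm
  have cont1 : ∀ i, ContinuousOn (fun x : Curve => x.coord i / x.coord 1) S := fun i =>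
    (continuousOn_coord_div i).mono fun x hx => (hover x hx).choose_spec.2.1
  have contPar : ContinuousOn (edgePar j) S := by
    unfold edgePar
    refine ContinuousOn.div ?_ ?_ ?_
    · exact ((cont1 2).pow 2).sub continuousOn_const
    · exact (((cont1 2).pow 2).sub continuousOn_const).add (continuousOn_const.mul
        ((((cont1 2).pow 2).mul continuousOn_const).sub continuousOn_const))
    · intro x hx
      exact (edgePar_denom_ne_zero (hover x hx).choose_spec.2).1
  have contRoot : ∀ i, ContinuousOn (fun x => edgeRoot j i (edgePar j x)) S := by
    intro i x hx
    obtain ⟨t, ht, h⟩ := hover x hx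
    have hc := continuousAt_edgeRoot j i t
    rw [← (edgePar_denom_ne_zero h).2] at hc
    exact hc.comp_continuousWithinAt (contPar x hx)
  have rootNe : ∀ i, ∀ x ∈ S, edgeRoot j i (edgePar j x) ≠ 0 := by
    intro i x hx
    obtain ⟨t, ht, h⟩ := hover x hx
    rw [(edgePar_denom_ne_zero h).2]
    exact edgeRoot_ne_zero j i _
  -- Both functions are continuous square roots of the same nowhere vanishing function on a
  -- connected set, so they agree up to one global sign.
  have main := hpre.eq_or_eq_neg_of_sq_eq (f := fun y : Curve => y.coord i / y.coord 1)
    (g := fun y => x i / x 1 * (edgeRoot j i (edgePar j y) / edgeRoot j 1 (edgePar j y))) (cont1 i)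
    (continuousOn_const.mul ((contRoot i).div (contRoot 1) (rootNe 1)))
    (fun y hy => by
      obtain ⟨t, ht, h⟩ := hover y hy
      exact coord_div_sq h hx1 hx i)
    (fun {y} hy => mul_ne_zero (div_ne_zero (ne i) hx1) (div_ne_zero (rootNe i y hy) (rootNe 1 y hy)))
  have hpS : p ∈ S := Set.mem_insert _ _
  have hqS : q ∈ S := Set.mem_insert_of_mem _ (Set.mem_insert _ _)
  have ep := (edgePar_denom_ne_zero hps).2
  have eq := (edgePar_denom_ne_zero hqt).2
  rcases main with h | h
  · have h1 := h hpS
    have h2 := h hqS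
    simp only [ep, eq] at h1 h2
    rw [h1, h2]
    ring
  · have h1 := h hpS
    have h2 := h hqS
    simp only [Pi.neg_apply, ep, eq] at h1 h2
    rw [h1, h2]
    ring

/-- The coordinates, up to a common factor, of the white end of the edge of color `j` that starts
at a black point. -/
def acrossEdge (j : Fin 5) (x : Fin 5 → ℂ) : Fin 5 → ℂ := fun i => x i * zeta ^ edgeExp j i

theorem eq_of_coord_div {p q : Curve} (hp : p.coord 1 ≠ 0) (hq : q.coord 1 ≠ 0)
    (h : ∀ i, p.coord i / p.coord 1 = q.coord i / q.coord 1) : p = q := by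
  refine Curve.eq_of_coord (a := p.coord 1 / q.coord 1) (funext fun i => ?_)
  have := h i
  rw [div_eq_iff hp] at this
  rw [Pi.smul_apply, smul_eq_mul, this]
  field_simp

/-- Two points in the closure of an edge with the same parameter have the same coordinate ratios,
hence coincide. So distinct ends are of opposite classes, and the transport from parameter 0 to 1 is
multiplication by the values `edgeRoot j i 1`. -/
theorem edge_ends {j : Fin 5} {e : Set Curve} (he : e ∈ edges j) {p q : Curve}
    (hp : p ∈ closure e) (hq : q ∈ closure e) (hpv : p ∈ blackPoints ∪ whitePoints)
    (hqv : q ∈ blackPoints ∪ whitePoints) (hpq : p ≠ q) :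
    (p ∈ blackPoints ∧ q ∈ whitePoints ∧
      ∃ a : ℂ, a ≠ 0 ∧ q.coord = a • acrossEdge j p.coord) ∨
    (q ∈ blackPoints ∧ p ∈ whitePoints ∧
      ∃ a : ℂ, a ≠ 0 ∧ p.coord = a • acrossEdge j q.coord) := by
  have h0 : (0 : ℝ) ∈ Set.Icc (0 : ℝ) 1 := by simp
  have h1 : (1 : ℝ) ∈ Set.Icc (0 : ℝ) 1 := by simp
  have mixed : ∀ {p q : Curve}, p ∈ closure e → q ∈ closure e → p ∈ blackPoints →
      q ∈ whitePoints → ∃ a : ℂ, a ≠ 0 ∧ q.coord = a • acrossEdge j p.coord := by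
    intro p q hp hq hpb hqw
    have hpo := overEdge_zero hpb j
    have hqo := overEdge_one hqw j
    have key := exists_sign_of_mem_closure he hp hq h0 h1 hpo hqo
    have z1 : zeta ^ edgeExp j 1 ≠ 0 := pow_ne_zero _ zeta_ne_zero
    refine ⟨q.coord 1 / (p.coord 1 * zeta ^ edgeExp j 1),
      div_ne_zero hqo.1 (mul_ne_zero hpo.1 z1), funext fun i => ?_⟩
    have := key i
    simp only [Complex.ofReal_zero, Complex.ofReal_one, edgeRoot_zero, edgeRoot_one, div_one,
      mul_one] at this
    have hp1 := hpo.1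
    have hq1 := hqo.1
    rw [Pi.smul_apply, smul_eq_mul, acrossEdge]
    field_simp at this ⊢
    linear_combination -this
  have same : ∀ t ∈ Set.Icc (0 : ℝ) 1, OverEdge j t p → OverEdge j t q → False := by
    intro t ht hpo hqo
    refine hpq (eq_of_coord_div hpo.1 hqo.1 fun i => ?_)
    exact mul_right_cancel₀ (div_ne_zero (edgeRoot_ne_zero j i _) (edgeRoot_ne_zero j 1 _))
      (exists_sign_of_mem_closure he hp hq ht ht hpo hqo i)
  rcases hpv with hpb | hpw <;> rcases hqv with hqb | hqw
  · exact (same 0 h0 (overEdge_zero hpb j) (overEdge_zero hqb j)).elim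
  · exact Or.inl ⟨hpb, hqw, mixed hp hq hpb hqw⟩
  · exact Or.inr ⟨hqb, hpw, mixed hq hp hqb hpw⟩
  · exact (same 1 h1 (overEdge_one hpw j) (overEdge_one hqw j)).elim

/-! ### Existence of the edges -/

theorem curveEq_edge (j : Fin 5) {x : Fin 5 → ℂ} (hx : ∀ i, x i ^ 2 = sqCoeff i * x 1 ^ 2) (s : ℂ) :
    CurveEq fun i => x i * edgeRoot j i s := by
  refine curveEq_of_sq (α := x 1 ^ 2 * (1 - s)) (β := x 1 ^ 2 * s * zeta ^ (2 * (j : ℕ)))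
    fun i => ?_
  rw [mul_pow, edgeRoot_sq, hx i, edgeSq, pow_add]
  ring

theorem edge_ne_zero (j : Fin 5) {x : Fin 5 → ℂ} (hx1 : x 1 ≠ 0) (t : ℝ) :
    (fun i => x i * edgeRoot j i t) ≠ 0 := fun h =>
  mul_ne_zero hx1 (edgeRoot_ne_zero j 1 _) (congrFun h 1)

theorem proj_edge_mem_gamma (j : Fin 5) {x : Fin 5 → ℂ} (hx1 : x 1 ≠ 0)
    (hx : ∀ i, x i ^ 2 = sqCoeff i * x 1 ^ 2) {t : ℝ} (ht : t ∈ Set.Ioo (0 : ℝ) 1)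
    {p : Curve} {a : ℂ} (ha : a ≠ 0) (hp : p.coord = a • fun i => x i * edgeRoot j i t) :
    proj p ∈ gamma j := by
  have h1t : (0 : ℝ) < 1 - t := by linarith [ht.2]
  have hpos : 0 < t / (1 - t) := div_pos ht.1 h1t
  refine ⟨t / (1 - t), hpos, proj_of_sq (ray_ne hpos j) ?_ ?_⟩
  · rw [hp]
    exact mul_ne_zero ha (mul_ne_zero hx1 (edgeRoot_ne_zero j 1 _))
  · have h1t' : (1 - t : ℂ) ≠ 0 := by exact_mod_cast h1t.ne'
    rw [hp]
    simp only [Pi.smul_apply, smul_eq_mul, mul_pow, edgeRoot_sq, hx 2]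
    have e1 : edgeSq j 1 t = (1 - t) - t * (zeta ^ (2 * (j : ℕ)) * zeta) := by
      rw [edgeSq, pow_add]
      change 1 - (t : ℂ) - t * (zeta ^ (2 * (j : ℕ)) * zeta ^ 11) = _
      linear_combination -t * zeta ^ (2 * (j : ℕ)) * zeta * zeta_pow_ten
    have e2 : edgeSq j 2 t = (1 - t) - t * (zeta ^ (2 * (j : ℕ)) * zeta ^ 9) := by
      rw [edgeSq, pow_add]
      rfl
    rw [e1, e2]
    push_cast
    field_simp

/-- The explicit lift with coordinates x_i times `edgeRoot j i t`, for 0 < t < 1, lies in a single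
component of the preimage of the path, and its limits at 0 and 1 are the two points. -/
theorem exists_edge (j : Fin 5) {x : Fin 5 → ℂ} (hx1 : x 1 ≠ 0)
    (hx : ∀ i, x i ^ 2 = sqCoeff i * x 1 ^ 2) {p q : Curve} {a b : ℂ} (hp : p.coord = a • x)
    (hq : q.coord = b • acrossEdge j x) :
    ∃ e ∈ edges j, p ∈ closure e ∧ q ∈ closure e := by
  let c : Set.Icc (0 : ℝ) 1 → Curve := fun t =>
    Curve.mk (fun i => x i * edgeRoot j i (t : ℝ)) (edge_ne_zero j hx1 t) (curveEq_edge j hx _)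
  have hc : Continuous c := by
    refine continuous_curve_mk (continuous_pi fun i => continuous_const.mul ?_) _ _
    refine continuous_iff_continuousAt.2 fun t => ?_
    exact ContinuousAt.comp (f := fun t : Set.Icc (0 : ℝ) 1 => ((t : ℝ) : ℂ))
      (continuousAt_edgeRoot j i _)
      (Complex.continuous_ofReal.comp continuous_subtype_val).continuousAt
  let γ : ℝ → Curve := fun t => c (Set.projIcc 0 1 zero_le_one t)
  have hγ : Continuous γ := hc.comp continuous_projIcc
  have mem : ∀ t ∈ Set.Ioo (0 : ℝ) 1, γ t ∈ proj ⁻¹' gamma j := by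
    intro t ht
    have e : γ t = c ⟨t, Set.Ioo_subset_Icc_self ht⟩ := by
      simp only [γ]
      rw [Set.projIcc_of_mem]
    rw [e]
    obtain ⟨a, ha, h⟩ := Curve.exists_coord_mk _ (edge_ne_zero j hx1 t)
      (curveEq_edge j hx t)
    exact proj_edge_mem_gamma j hx1 hx ht ha h
  have half : (1 / 2 : ℝ) ∈ Set.Ioo (0 : ℝ) 1 := by norm_num
  set e := connectedComponentIn (proj ⁻¹' gamma j) (γ (1 / 2)) with he
  have sub : γ '' Set.Ioo 0 1 ⊆ e :=
    (isPreconnected_Ioo.image γ hγ.continuousOn).subset_connectedComponentIn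
      ⟨_, half, rfl⟩ (by rintro _ ⟨t, ht, rfl⟩; exact mem t ht)
  have cl : ∀ t ∈ Set.Icc (0 : ℝ) 1, γ t ∈ closure e := by
    intro t ht
    refine closure_mono sub (image_closure_subset_closure_image hγ ⟨t, ?_, rfl⟩)
    rwa [closure_Ioo zero_ne_one]
  refine ⟨e, ⟨_, mem _ half, rfl⟩, ?_, ?_⟩
  · have h0 : γ 0 = p := by
      have e0 : γ 0 = c ⟨0, by simp⟩ := by
        simp only [γ]
        rw [Set.projIcc_left]
      rw [e0]
      obtain ⟨a', ha', h⟩ := Curve.exists_coord_mk _ (edge_ne_zero j hx1 0)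
        (curveEq_edge j hx (0 : ℝ))
      have ha : a ≠ 0 := by
        rintro rfl
        exact p.coord_ne_zero (by rw [hp, zero_smul])
      refine Curve.eq_of_coord (a := a' / a) (h.trans ?_)
      rw [hp, smul_smul, div_mul_cancel₀ _ ha]
      congr 1
      funext i
      rw [Complex.ofReal_zero, edgeRoot_zero, mul_one]
    exact h0 ▸ cl 0 (by simp)
  · have h0 : γ 1 = q := by
      have e0 : γ 1 = c ⟨1, by simp⟩ := by
        simp only [γ]
        rw [Set.projIcc_right]
      rw [e0]
      obtain ⟨a', ha', h⟩ := Curve.exists_coord_mk _ (edge_ne_zero j hx1 1)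
        (curveEq_edge j hx (1 : ℝ))
      have hb : b ≠ 0 := by
        rintro rfl
        exact q.coord_ne_zero (by rw [hq, zero_smul])
      refine Curve.eq_of_coord (a := a' / b) (h.trans ?_)
      rw [hq, smul_smul, div_mul_cancel₀ _ hb]
      congr 1
      funext i
      rw [Complex.ofReal_one, edgeRoot_one, acrossEdge]
    exact h0 ▸ cl 1 (by simp)

/-! ### The curves `E_k` and uniform formulas for the maps `ν_k` -/

theorem fin_five_cases (k : Fin 5) : k = 0 ∨ k = 1 ∨ k = 2 ∨ k = 3 ∨ k = 4 := by
  revert k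
  decide

/-- The third finite branch point of `E_k` as a complex number. -/
def lamC : Fin 5 → ℂ := ![phi, phi + 1, phi, -phi, phi + 1]

theorem coe_lam_eq (k : Fin 5) : (lam k : ℂ) = lamC k := by
  rw [coe_lam]
  rcases fin_five_cases k with rfl | rfl | rfl | rfl | rfl <;> simp [lamC]

theorem isLegendre_E (k : Fin 5) : IsLegendre ((E k).baseChange ℂ).toAffine (lamC k) := by
  rw [← coe_lam_eq]
  simp [IsLegendre, WeierstrassCurve.baseChange, WeierstrassCurve.map, E,
    IntermediateField.algebraMap_apply]

theorem nonsingular_E {k : Fin 5} {x y : ℂ} (h : y ^ 2 = x * (x - 1) * (x - lamC k)) :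
    ((E k).baseChange ℂ).toAffine.Nonsingular x y := by
  have hE : ((E k).baseChange ℂ).IsElliptic :=
    inferInstanceAs ((E k).map (algebraMap (numField k) ℂ)).IsElliptic
  exact (WeierstrassCurve.Affine.equation_iff_nonsingular
    (W := ((E k).baseChange ℂ).toAffine)).1 (((isLegendre_E k).equation_iff _ _).2 h)

theorem some_mem_mordellWeil {k : Fin 5} {x y : ℂ}
    (h : ((E k).baseChange ℂ).toAffine.Nonsingular x y) (hx : x ∈ numField k)
    (hy : y ∈ numField k) :
    WeierstrassCurve.Affine.Point.some x y h ∈ mordellWeil k := by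
  have h' : ((E k).baseChange (numField k)).toAffine.Nonsingular ⟨x, hx⟩ ⟨y, hy⟩ :=
    (WeierstrassCurve.Affine.baseChange_nonsingular (E k) (f := Algebra.ofId (numField k) ℂ)
      (Algebra.ofId (numField k) ℂ).injective _ _).1 h
  exact ⟨.some ⟨x, hx⟩ ⟨y, hy⟩ h', rfl⟩

/-- `ν_k` in terms of the squares of two consecutive coordinates. -/
theorem nuX_eq (k : Fin 5) (x : Fin 5 → ℂ) :
    nuX k x = (![-1, -(2 * phi + 1), 1, 2 * phi + 1, phi + 1] : Fin 5 → ℂ) k *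
      (x k ^ 2 / x (k - 1) ^ 2) +
        (![phi + 1, -phi, phi + 1, phi + 1, -phi] : Fin 5 → ℂ) k := by
  rcases fin_five_cases k with rfl | rfl | rfl | rfl | rfl
  · change -(x 5 ^ 2 / x 4 ^ 2) + phi + 1 = -1 * (x 5 ^ 2 / x 4 ^ 2) + (phi + 1)
    ring
  · change -(2 * phi + 1) * (x 1 ^ 2 / x 5 ^ 2) - phi = -(2 * phi + 1) * (x 1 ^ 2 / x 5 ^ 2) + -phi
    ring
  · change x 2 ^ 2 / x 1 ^ 2 + phi + 1 = 1 * (x 2 ^ 2 / x 1 ^ 2) + (phi + 1)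
    ring
  · change (2 * phi + 1) * (x 3 ^ 2 / x 2 ^ 2) + phi + 1 =
      (2 * phi + 1) * (x 3 ^ 2 / x 2 ^ 2) + (phi + 1)
    ring
  · change (phi + 1) * (x 4 ^ 2 / x 3 ^ 2) - phi = (phi + 1) * (x 4 ^ 2 / x 3 ^ 2) + -phi
    ring

/-- The value of the constant never matters: the sign picked up along an edge and the zeros of the
y-coordinate depend only on this monomial, which has one shape for all k. -/
theorem exists_nuY_eq (k : Fin 5) : ∃ c : ℂ, ∀ x : Fin 5 → ℂ,
    nuY k x = c * (x (k + 1) * x (k + 2) * x (k + 3) / x (k - 1) ^ 3) := by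
  rcases fin_five_cases k with rfl | rfl | rfl | rfl | rfl
  · exact ⟨_, fun x => rfl⟩
  · exact ⟨_, fun x => rfl⟩
  · exact ⟨_, fun x => rfl⟩
  · refine ⟨Complex.I * (2 * phi + 1), fun x => ?_⟩
    change Complex.I * (2 * phi + 1) * (x 1 * x 4 * x 5 / x 2 ^ 3) =
      Complex.I * (2 * phi + 1) * (x 4 * x 5 * x 1 / x 2 ^ 3)
    ring
  · refine ⟨Complex.I * phi, fun x => ?_⟩
    change Complex.I * phi * (x 1 * x 2 * x 5 / x 3 ^ 3) =
      Complex.I * phi * (x 5 * x 1 * x 2 / x 3 ^ 3)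
    ring

theorem nuY_smul (k : Fin 5) {a : ℂ} (ha : a ≠ 0) (x : Fin 5 → ℂ) : nuY k (a • x) = nuY k x := by
  obtain ⟨c, hc⟩ := exists_nuY_eq k
  rw [hc, hc]
  simp only [Pi.smul_apply, smul_eq_mul, mul_pow]
  rw [← mul_div_mul_left (x (k + 1) * x (k + 2) * x (k + 3)) _ (pow_ne_zero 3 ha)]
  ring

theorem nu_eq_some {k : Fin 5} {p : Curve} (h : p.coord (k - 1) ≠ 0) :
    nu k p = .some (nuX k p.coord) (nuY k p.coord) (nu_nonsingular k p.coord p.2 h) :=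
  dif_neg h

/-! ### The images of the vertices -/

/-- The exponent of `ζ` in the `x`-coordinates of the images of the black points. -/
def vertexExp : Fin 5 → ℕ := ![9, 2, 9, 8, 2]

theorem phi_mul_sub_one : phi * (phi - 1) = 1 := by linear_combination phi_sq

/-- The inverses of the `sqCoeff i`. -/
def sqCoeffInv : Fin 5 → ℂ := ![(phi - 1) * zeta ^ 6, 1, -((phi - 1) * zeta ^ 9), zeta ^ 8, zeta ^ 7]

theorem sqCoeff_mul_inv (i : Fin 5) : sqCoeff i * sqCoeffInv i = 1 := by
  have h := phi_mul_sub_one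
  have hz := zeta_pow_ten
  rcases fin_five_cases i with rfl | rfl | rfl | rfl | rfl
  · change phi * zeta ^ 4 * ((phi - 1) * zeta ^ 6) = 1
    linear_combination zeta ^ 10 * h + hz
  · exact mul_one 1
  · change -(phi * zeta) * -((phi - 1) * zeta ^ 9) = 1
    linear_combination zeta ^ 10 * h + hz
  · change zeta ^ 2 * zeta ^ 8 = 1
    linear_combination hz
  · change zeta ^ 3 * zeta ^ 7 = 1
    linear_combination hz

theorem nuX_black (k : Fin 5) {x : Fin 5 → ℂ} (h1 : x 1 ≠ 0)
    (hx : ∀ i, x i ^ 2 = sqCoeff i * x 1 ^ 2) : nuX k x = phi * zeta ^ vertexExp k := by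
  have r : x k ^ 2 / x (k - 1) ^ 2 = sqCoeff k * sqCoeffInv (k - 1) := by
    have := sqCoeff_ne_zero (k - 1)
    rw [hx k, hx (k - 1), div_eq_iff (mul_ne_zero this (pow_ne_zero 2 h1))]
    linear_combination -sqCoeff k * x 1 ^ 2 * sqCoeff_mul_inv (k - 1)
  rw [nuX_eq, r]
  clear r hx h1
  have hz := zeta_poly
  rcases fin_five_cases k with rfl | rfl | rfl | rfl | rfl
  · change -1 * (phi * zeta ^ 4 * zeta ^ 7) + (phi + 1) = phi * zeta ^ 9
    rw [phi_eq_sub]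
    grind
  · change -(2 * phi + 1) * (1 * ((phi - 1) * zeta ^ 6)) + -phi = phi * zeta ^ 2
    rw [phi_eq_sub]
    grind
  · change 1 * (-(phi * zeta) * 1) + (phi + 1) = phi * zeta ^ 9
    rw [phi_eq_sub]
    grind
  · change (2 * phi + 1) * (zeta ^ 2 * -((phi - 1) * zeta ^ 9)) + (phi + 1) = phi * zeta ^ 8
    rw [phi_eq_sub]
    grind
  · change (phi + 1) * (zeta ^ 3 * zeta ^ 8) + -phi = phi * zeta ^ 2
    rw [phi_eq_sub]
    grind

theorem nuX_white (k : Fin 5) {x : Fin 5 → ℂ} (h1 : x 1 ≠ 0)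
    (hx : ∀ i : Fin 5, x i ^ 2 = sqCoeff i * zeta ^ (12 - 2 * (i : ℕ)) * x 1 ^ 2) :
    nuX k x = phi * (zeta ^ 9) ^ vertexExp k := by
  have r : x k ^ 2 / x (k - 1) ^ 2 = sqCoeff k * sqCoeffInv (k - 1) * zeta ^ 8 := by
    have h2 := sqCoeff_ne_zero (k - 1)
    have h3 : zeta ^ (12 - 2 * ((k - 1 : Fin 5) : ℕ)) ≠ 0 := pow_ne_zero _ zeta_ne_zero
    have e : zeta ^ (12 - 2 * ((k : Fin 5) : ℕ)) = zeta ^ (12 - 2 * ((k - 1 : Fin 5) : ℕ)) * zeta ^ 8 := by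
      rw [← pow_add, zeta_pow_mod, zeta_pow_mod (12 - 2 * ((k - 1 : Fin 5) : ℕ) + 8)]
      congr 1
      clear * -
      revert k
      decide
    rw [hx k, hx (k - 1), div_eq_iff (mul_ne_zero (mul_ne_zero h2 h3) (pow_ne_zero 2 h1)), e]
    linear_combination -sqCoeff k * x 1 ^ 2 * zeta ^ (12 - 2 * ((k - 1 : Fin 5) : ℕ)) * zeta ^ 8 *
      sqCoeff_mul_inv (k - 1)
  rw [nuX_eq, r, ← pow_mul, zeta_pow_mod (9 * vertexExp k)]
  clear r hx h1
  have hz := zeta_poly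
  rcases fin_five_cases k with rfl | rfl | rfl | rfl | rfl
  · change -1 * (phi * zeta ^ 4 * zeta ^ 7 * zeta ^ 8) + (phi + 1) = phi * zeta ^ 1
    rw [phi_eq_sub]
    grind
  · change -(2 * phi + 1) * (1 * ((phi - 1) * zeta ^ 6) * zeta ^ 8) + -phi = phi * zeta ^ 8
    rw [phi_eq_sub]
    grind
  · change 1 * (-(phi * zeta) * 1 * zeta ^ 8) + (phi + 1) = phi * zeta ^ 1
    rw [phi_eq_sub]
    grind
  · change (2 * phi + 1) * (zeta ^ 2 * -((phi - 1) * zeta ^ 9) * zeta ^ 8) + (phi + 1) = phi * zeta ^ 2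
    rw [phi_eq_sub]
    grind
  · change (phi + 1) * (zeta ^ 3 * zeta ^ 8 * zeta ^ 8) + -phi = phi * zeta ^ 8
    rw [phi_eq_sub]
    grind

theorem coord_ne_zero_of_vertex {p : Curve} (hp : p ∈ blackPoints ∪ whitePoints) (i : Fin 5) :
    p.coord i ≠ 0 := by
  intro h
  rcases hp with hp | hp
  · obtain ⟨h1, h2⟩ := mem_blackPoints.1 hp
    have := h2 i
    rw [h, zero_pow two_ne_zero] at this
    exact mul_ne_zero (sqCoeff_ne_zero i) (pow_ne_zero 2 h1) this.symm
  · obtain ⟨h1, h2⟩ := mem_whitePoints.1 hp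
    have := h2 i
    rw [h, zero_pow two_ne_zero] at this
    exact mul_ne_zero (mul_ne_zero (sqCoeff_ne_zero i) (pow_ne_zero _ zeta_ne_zero))
      (pow_ne_zero 2 h1) this.symm

/-- Black and white points differ by ζ ↔ ζ⁻¹ = ζ^9. Both are roots z of the cyclotomic polynomial
with φ = z - z⁴, so later computations can be done once for a general z. -/
theorem exists_nuX_vertex (k : Fin 5) {p : Curve} (hp : p ∈ blackPoints ∪ whitePoints) :
    ∃ z : ℂ, z ^ 4 - z ^ 3 + z ^ 2 - z + 1 = 0 ∧ phi = z - z ^ 4 ∧ z ∈ numField k ∧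
      nuX k p.coord = phi * z ^ vertexExp k := by
  have hz := zeta_poly
  rcases hp with hp | hp
  · obtain ⟨h1, h2⟩ := mem_blackPoints.1 hp
    exact ⟨zeta, hz, phi_eq_sub, zeta_mem k, nuX_black k h1 h2⟩
  · obtain ⟨h1, h2⟩ := mem_whitePoints.1 hp
    refine ⟨zeta ^ 9, ?_, ?_, pow_mem (zeta_mem k) 9, nuX_white k h1 h2⟩
    · grind
    · rw [phi_eq_sub]
      grind

/-- The `x`-coordinate of the double of the images of the face centers of order `4`. -/
def torsionX : Fin 5 → ℂ := ![phi, 0, phi, 1, 0]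

theorem torsionX_eq (k : Fin 5) :
    (0 : ℂ) ^ 2 = torsionX k * (torsionX k - 1) * (torsionX k - lamC k) := by
  rcases fin_five_cases k with rfl | rfl | rfl | rfl | rfl <;> simp [torsionX, lamC]

/-- The point of order `2` by which the images of the ends of an edge differ, up to sign. -/
def twoTorsion (k : Fin 5) : EPoint k := .some (torsionX k) 0 (nonsingular_E (torsionX_eq k))

theorem twoTorsion_add_self (k : Fin 5) : twoTorsion k + twoTorsion k = 0 :=
  (isLegendre_E k).add_self_eq_zero _

/-- The derivative of the cubic at `torsionX k`. -/
theorem torsionX_deriv (k : Fin 5) :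
    3 * torsionX k ^ 2 - 2 * (1 + lamC k) * torsionX k + lamC k =
      (![1, phi ^ 2, 1, phi ^ 2, phi ^ 2] : Fin 5 → ℂ) k := by
  have h := phi_sq
  rcases fin_five_cases k with rfl | rfl | rfl | rfl | rfl
  · change 3 * phi ^ 2 - 2 * (1 + phi) * phi + phi = 1
    linear_combination h
  · change 3 * 0 ^ 2 - 2 * (1 + (phi + 1)) * 0 + (phi + 1) = phi ^ 2
    linear_combination -h
  · change 3 * phi ^ 2 - 2 * (1 + phi) * phi + phi = 1
    linear_combination h
  · change 3 * 1 ^ 2 - 2 * (1 + -phi) * 1 + -phi = phi ^ 2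
    linear_combination -h
  · change 3 * 0 ^ 2 - 2 * (1 + (phi + 1)) * 0 + (phi + 1) = phi ^ 2
    linear_combination -h

theorem torsionX_deriv_ne_zero (k : Fin 5) :
    3 * torsionX k ^ 2 - 2 * (1 + lamC k) * torsionX k + lamC k ≠ 0 := by
  have := phi_ne_zero
  rw [torsionX_deriv]
  rcases fin_five_cases k with rfl | rfl | rfl | rfl | rfl <;> simp [this]

/-! ### Crossing an edge as translation by a 2-torsion point -/

/-- Together with `vertexX_ratio` this verifies the hypotheses of `IsLegendre.add_two_torsion`:
translating (X, Y) at a black point by `twoTorsion k` gives the white x-coordinate and the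
y-coordinate ζY. -/
theorem vertexX_mul (k : Fin 5) :
    (phi * (zeta ^ 9) ^ vertexExp k - torsionX k) * (phi * zeta ^ vertexExp k - torsionX k) =
      3 * torsionX k ^ 2 - 2 * (1 + lamC k) * torsionX k + lamC k := by
  rw [torsionX_deriv, ← pow_mul, zeta_pow_mod (9 * vertexExp k)]
  have hz := zeta_poly
  rcases fin_five_cases k with rfl | rfl | rfl | rfl | rfl
  · change (phi * zeta ^ 1 - phi) * (phi * zeta ^ 9 - phi) = 1
    rw [phi_eq_sub]
    grind
  · change (phi * zeta ^ 8 - 0) * (phi * zeta ^ 2 - 0) = phi ^ 2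
    rw [phi_eq_sub]
    grind
  · change (phi * zeta ^ 1 - phi) * (phi * zeta ^ 9 - phi) = 1
    rw [phi_eq_sub]
    grind
  · change (phi * zeta ^ 2 - 1) * (phi * zeta ^ 8 - 1) = phi ^ 2
    rw [phi_eq_sub]
    grind
  · change (phi * zeta ^ 8 - 0) * (phi * zeta ^ 2 - 0) = phi ^ 2
    rw [phi_eq_sub]
    grind

theorem vertexX_ratio (k : Fin 5) :
    zeta * (phi * zeta ^ vertexExp k - torsionX k) =
      -(phi * (zeta ^ 9) ^ vertexExp k - torsionX k) := by
  rw [← pow_mul, zeta_pow_mod (9 * vertexExp k)]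
  have hz := zeta_poly
  rcases fin_five_cases k with rfl | rfl | rfl | rfl | rfl
  · change zeta * (phi * zeta ^ 9 - phi) = -(phi * zeta ^ 1 - phi)
    rw [phi_eq_sub]
    grind
  · change zeta * (phi * zeta ^ 2 - 0) = -(phi * zeta ^ 8 - 0)
    rw [phi_eq_sub]
    grind
  · change zeta * (phi * zeta ^ 9 - phi) = -(phi * zeta ^ 1 - phi)
    rw [phi_eq_sub]
    grind
  · change zeta * (phi * zeta ^ 8 - 1) = -(phi * zeta ^ 2 - 1)
    rw [phi_eq_sub]
    grind
  · change zeta * (phi * zeta ^ 2 - 0) = -(phi * zeta ^ 8 - 0)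
    rw [phi_eq_sub]
    grind

/-- The sign by which the images of the ends of an edge of color `j` differ, up to torsion. -/
def edgeSign (k j : Fin 5) : ℤ := if j = k ∨ j = k + 2 then 1 else -1

theorem edgeSign_eq (k j : Fin 5) : edgeSign k j = 1 ∨ edgeSign k j = -1 := by
  unfold edgeSign
  split_ifs <;> simp

/-- The exponents of the three numerator coordinates, minus three times that of the denominator, sum
to 1 modulo 10 for j = k and j = k + 2, and otherwise to 6, where ζ^6 = -ζ. -/
theorem nuY_acrossEdge (k j : Fin 5) (x : Fin 5 → ℂ) :
    nuY k (acrossEdge j x) = edgeSign k j * (zeta * nuY k x) := by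
  obtain ⟨c, hc⟩ := exists_nuY_eq k
  -- The factor 7 stands for -3 modulo 10, the cube in the denominator.
  have e : zeta ^ (edgeExp j (k + 1) + edgeExp j (k + 2) + edgeExp j (k + 3) +
      7 * edgeExp j (k - 1)) = edgeSign k j * zeta := by
    rw [zeta_pow_mod]
    have : (edgeExp j (k + 1) + edgeExp j (k + 2) + edgeExp j (k + 3) +
        7 * edgeExp j (k - 1)) % 10 = if j = k ∨ j = k + 2 then 1 else 6 := by
      clear hc
      revert j k
      decide
    rw [this, edgeSign]
    split_ifs
    · simp
    · push_cast
      linear_combination zeta * zeta_pow_five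
  have e10 : (zeta ^ edgeExp j (k - 1)) ^ 10 = 1 := by
    rw [← pow_mul, mul_comm, pow_mul, zeta_pow_ten, one_pow]
  have z0 : zeta ^ edgeExp j (k - 1) ≠ 0 := pow_ne_zero _ zeta_ne_zero
  rw [hc, hc, ← mul_assoc, ← e]
  simp only [acrossEdge, pow_add, mul_comm 7, pow_mul, mul_pow]
  rw [← mul_div_mul_right _ (x (k - 1) ^ 3 * _) (pow_ne_zero 7 z0), mul_assoc (x (k - 1) ^ 3),
    ← pow_add, e10, mul_one]
  ring

/-- For sign +1 this is the translation formula. For sign -1 the image is -(P + D) = -P + D, since D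
has order 2. -/
theorem nu_acrossEdge (k : Fin 5) {j : Fin 5} {p q : Curve} (hp : p ∈ blackPoints)
    (hq : q ∈ whitePoints) {a : ℂ} (ha : a ≠ 0) (hpq : q.coord = a • acrossEdge j p.coord) :
    nu k q = edgeSign k j • nu k p + twoTorsion k := by
  have hp0 := coord_ne_zero_of_vertex (Or.inl hp) (k - 1)
  have hq0 := coord_ne_zero_of_vertex (Or.inr hq) (k - 1)
  obtain ⟨hp1, hp2⟩ := mem_blackPoints.1 hp
  obtain ⟨hq1, hq2⟩ := mem_whitePoints.1 hq
  have hW := isLegendre_E k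
  rw [nu_eq_some hp0, nu_eq_some hq0]
  have hX := nuX_black k hp1 hp2
  have hX' := nuX_white k hq1 hq2
  have hY' : nuY k q.coord = edgeSign k j * (zeta * nuY k p.coord) := by
    rw [hpq, nuY_smul k ha, nuY_acrossEdge]
  have nq := nu_nonsingular k q.coord q.2 hq0
  have n' : ((E k).baseChange ℂ).toAffine.Nonsingular (nuX k q.coord) (zeta * nuY k p.coord) := by
    apply nonsingular_E
    rw [← (hW.equation_iff _ _).1 nq.1, hY', mul_pow]
    rcases edgeSign_eq k j with h | h <;> rw [h] <;> push_cast <;> ring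
  have hmul := vertexX_mul k
  have hne : nuX k p.coord ≠ torsionX k := by
    intro h
    apply torsionX_deriv_ne_zero k
    rw [← hmul, ← hX, h, sub_self, mul_zero]
  have main := hW.add_two_torsion (nu_nonsingular k p.coord p.2 hp0)
    (nonsingular_E (torsionX_eq k)) n' hne (by rw [hX, hX', hmul]) (by
      rw [hX, hX']
      linear_combination nuY k p.coord * vertexX_ratio k)
  change _ + twoTorsion k = _ at main
  rcases edgeSign_eq k j with h | h
  · simp only [h, Int.cast_one, one_mul] at hY' ⊢
    rw [one_smul, main]
    congr 1
  · simp only [h, Int.cast_neg, Int.cast_one, neg_one_mul] at hY' ⊢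
    have e : -(WeierstrassCurve.Affine.Point.some (nuX k q.coord) (zeta * nuY k p.coord) n') =
        .some (nuX k q.coord) (nuY k q.coord) nq := by
      have n2 : ((E k).baseChange ℂ).toAffine.Nonsingular (nuX k q.coord)
        (-(zeta * nuY k p.coord)) := hY' ▸ nq
      rw [hW.neg_some n' n2]
      congr 1
      exact hY'.symm
    rw [← e, ← main, neg_add, neg_smul, one_smul,
      neg_eq_of_add_eq_zero_left (twoTorsion_add_self k)]

theorem eq_sign_smul_add_symm {A : Type*} [AddCommGroup A] {s : ℤ} (hs : s = 1 ∨ s = -1)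
    {P Q D : A} (hD : D + D = 0) (h : P = s • Q + D) : Q = s • P + D := by
  have hD' : -D = D := neg_eq_of_add_eq_zero_left hD
  rcases hs with rfl | rfl
  · rw [h, one_smul, one_smul, add_assoc, hD, add_zero]
  · rw [h, neg_smul, neg_smul, one_smul, one_smul, neg_add, neg_neg, hD', add_assoc, hD, add_zero]

/-- The images of the two ends of an edge. -/
theorem nu_edge (k : Fin 5) {j : Fin 5} {e : Set Curve} (he : e ∈ edges j) {p q : Curve}
    (hp : p ∈ closure e) (hq : q ∈ closure e) (hpv : p ∈ blackPoints ∪ whitePoints)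
    (hqv : q ∈ blackPoints ∪ whitePoints) (hpq : p ≠ q) :
    nu k q = edgeSign k j • nu k p + twoTorsion k := by
  rcases edge_ends he hp hq hpv hqv hpq with ⟨hb, hw, a, ha, h⟩ | ⟨hb, hw, a, ha, h⟩
  · exact nu_acrossEdge k hb hw ha h
  · exact eq_sign_smul_add_symm (edgeSign_eq k j) (twoTorsion_add_self k)
      (nu_acrossEdge k hb hw ha h)

/-! ### The images of the vertices are rational and have infinite order -/

theorem I_mem (k : Fin 5) : Complex.I ∈ numField k := by
  unfold numField
  split_ifs <;> exact IntermediateField.subset_adjoin _ _ (by simp)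

theorem exists_sq_eq_phi {k : Fin 5} (hk : k = 0 ∨ k = 2) : ∃ s ∈ numField k, s ^ 2 = phi := by
  refine ⟨((Real.sqrt Real.goldenRatio : ℝ) : ℂ), ?_, ?_⟩
  · unfold numField
    rw [if_pos (by rcases hk with rfl | rfl <;> decide)]
    exact IntermediateField.subset_adjoin _ _ (by simp)
  · rw [phi, ← Complex.ofReal_pow, Real.sq_sqrt Real.goldenRatio_pos.le]

theorem ne_zero_of_poly {z : ℂ} (hz : z ^ 4 - z ^ 3 + z ^ 2 - z + 1 = 0) : z ≠ 0 := by
  rintro rfl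
  norm_num at hz

/-- Explicit square roots of the cubic, giving rationality of the vertex images and y ≠ 0. The roots
involve √φ for k = 2, 5 (index 0 being 5) and i for k = 1, 4. -/
theorem exists_sq_vertexX (k : Fin 5) {z : ℂ} (hz : z ^ 4 - z ^ 3 + z ^ 2 - z + 1 = 0)
    (hphi : phi = z - z ^ 4) (hzk : z ∈ numField k) :
    ∃ y ∈ numField k, y ≠ 0 ∧ y ^ 2 = (phi * z ^ vertexExp k) * (phi * z ^ vertexExp k - 1) *
      (phi * z ^ vertexExp k - lamC k) := by
  have hz0 := ne_zero_of_poly hz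
  have hp0 := phi_ne_zero
  have hpk := phi_mem k
  have c02 : ∀ s : ℂ, s ^ 2 = phi →
      (s * z ^ 7) ^ 2 = (phi * z ^ 9) * (phi * z ^ 9 - 1) * (phi * z ^ 9 - phi) := by
    intro s hs
    rw [mul_pow, hs, hphi]
    clear hs hphi
    grind
  have c14 : (Complex.I * (phi ^ 2 * z ^ 2)) ^ 2 =
      (phi * z ^ 2) * (phi * z ^ 2 - 1) * (phi * z ^ 2 - (phi + 1)) := by
    rw [mul_pow, Complex.I_sq, hphi]
    clear hphi
    grind
  rcases fin_five_cases k with rfl | rfl | rfl | rfl | rfl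
  · obtain ⟨s, hs, h⟩ := exists_sq_eq_phi (k := 0) (Or.inl rfl)
    refine ⟨s * z ^ 7, mul_mem hs (pow_mem hzk 7), mul_ne_zero ?_ (pow_ne_zero 7 hz0), c02 s h⟩
    rintro rfl
    exact hp0 (by rw [← h]; norm_num)
  · exact ⟨_, mul_mem (I_mem 1) (mul_mem (pow_mem hpk 2) (pow_mem hzk 2)),
      mul_ne_zero Complex.I_ne_zero (mul_ne_zero (pow_ne_zero 2 hp0) (pow_ne_zero 2 hz0)), c14⟩
  · obtain ⟨s, hs, h⟩ := exists_sq_eq_phi (k := 2) (Or.inr rfl)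
    refine ⟨s * z ^ 7, mul_mem hs (pow_mem hzk 7), mul_ne_zero ?_ (pow_ne_zero 7 hz0), c02 s h⟩
    rintro rfl
    exact hp0 (by rw [← h]; norm_num)
  · refine ⟨phi ^ 2 * z ^ 2, mul_mem (pow_mem hpk 2) (pow_mem hzk 2),
      mul_ne_zero (pow_ne_zero 2 hp0) (pow_ne_zero 2 hz0), ?_⟩
    change (phi ^ 2 * z ^ 2) ^ 2 = (phi * z ^ 8) * (phi * z ^ 8 - 1) * (phi * z ^ 8 - -phi)
    rw [hphi]
    clear hphi
    grind
  · exact ⟨_, mul_mem (I_mem 4) (mul_mem (pow_mem hpk 2) (pow_mem hzk 2)),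
      mul_ne_zero Complex.I_ne_zero (mul_ne_zero (pow_ne_zero 2 hp0) (pow_ne_zero 2 hz0)), c14⟩

/-- The number X² - λ, the numerator in the duplication formula, divides 5 in ℤ[z]; u is the
cofactor. Hence it is a unit at every place over 2. -/
theorem exists_mul_eq_five (k : Fin 5) {z : ℂ} (hz : z ^ 4 - z ^ 3 + z ^ 2 - z + 1 = 0)
    (hphi : phi = z - z ^ 4) {V : ValuationSubring ℂ} (hzV : z ∈ V) :
    ∃ u ∈ V, ((phi * z ^ vertexExp k) ^ 2 - lamC k) * u = 5 := by
  have h5 : (5 : ℂ) ∈ V := by exact_mod_cast natCast_mem V 5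
  have h7 : (7 : ℂ) ∈ V := by exact_mod_cast natCast_mem V 7
  have h8 : (8 : ℂ) ∈ V := by exact_mod_cast natCast_mem V 8
  have h4 : (4 : ℂ) ∈ V := by exact_mod_cast natCast_mem V 4
  have u1 : 1 - 7 * z + 8 * z ^ 2 - 4 * z ^ 3 ∈ V :=
    sub_mem (add_mem (sub_mem (one_mem V) (mul_mem h7 hzV)) (mul_mem h8 (pow_mem hzV 2)))
      (mul_mem h4 (pow_mem hzV 3))
  have u2 : 5 * (1 - z + z ^ 3) ∈ V :=
    mul_mem h5 (add_mem (sub_mem (one_mem V) hzV) (pow_mem hzV 3))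
  have u3 : 5 * (z - 1) ∈ V := mul_mem h5 (sub_mem hzV (one_mem V))
  have c02 : ((phi * z ^ 9) ^ 2 - phi) * (5 * (1 - z + z ^ 3)) = 5 := by
    rw [hphi]
    clear hphi
    grind
  have c14 : ((phi * z ^ 2) ^ 2 - (phi + 1)) * (1 - 7 * z + 8 * z ^ 2 - 4 * z ^ 3) = 5 := by
    rw [hphi]
    clear hphi
    grind
  rcases fin_five_cases k with rfl | rfl | rfl | rfl | rfl
  · exact ⟨_, u2, c02⟩
  · exact ⟨_, u1, c14⟩
  · exact ⟨_, u2, c02⟩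
  · refine ⟨_, u3, ?_⟩
    change ((phi * z ^ 8) ^ 2 - -phi) * (5 * (z - 1)) = 5
    rw [hphi]
    clear hphi
    grind
  · exact ⟨_, u1, c14⟩

/-- The point itself is integral over 2, so `IsLegendre.not_isOfFinAddOrder` is applied to its
double, whose x-coordinate is ((X² - λ) / (2Y))²: a unit numerator, an integral Y, and a 2 in the
denominator. -/
theorem nu_vertex_not_isOfFinAddOrder (k : Fin 5) {p : Curve}
    (hp : p ∈ blackPoints ∪ whitePoints) : ¬ IsOfFinAddOrder (nu k p) := by
  obtain ⟨V, v2⟩ := exists_valuationSubring_two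
  obtain ⟨z, hz, hphi, hzk, hX⟩ := exists_nuX_vertex k hp
  obtain ⟨y, -, hy0, hy⟩ := exists_sq_vertexX k hz hphi hzk
  have hz10 : z ^ 10 = 1 := by
    clear hphi hX hy
    grind
  have hzV : z ∈ V := by
    rw [← V.valuation_le_one_iff]
    have : V.valuation z ^ 10 = 1 := by rw [← map_pow, hz10, map_one]
    exact not_lt.1 fun h => (one_lt_pow₀ h (by norm_num)).ne' this
  have hphiV : phi ∈ V := hphi ▸ sub_mem hzV (pow_mem hzV 4)
  have hlV : lamC k ∈ V := by
    rcases fin_five_cases k with rfl | rfl | rfl | rfl | rfl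
    · exact hphiV
    · exact add_mem hphiV (one_mem V)
    · exact hphiV
    · exact neg_mem hphiV
    · exact add_mem hphiV (one_mem V)
  obtain ⟨u, huV, hu⟩ := exists_mul_eq_five k hz hphi hzV
  rw [nu_eq_some (coord_ne_zero_of_vertex hp (k - 1))]
  have hW := isLegendre_E k
  have hn := nu_nonsingular k p.coord p.2 (coord_ne_zero_of_vertex hp (k - 1))
  have heq := (hW.equation_iff _ _).1 hn.1
  have hXV : nuX k p.coord ∈ V := by
    rw [hX]
    exact mul_mem hphiV (pow_mem hzV _)
  rw [← hX] at hy hu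
  have hY0 : nuY k p.coord ≠ 0 := by
    intro h
    rw [h, ← hy] at heq
    exact pow_ne_zero 2 hy0 (by rw [← heq]; norm_num)
  have h2 : (2 : ℂ) ≠ 0 := two_ne_zero
  obtain ⟨y', h', hdouble⟩ := hW.add_self h2 hn hY0
  have hYV : V.valuation (nuY k p.coord) ^ 2 ≤ 1 := by
    rw [← map_pow, V.valuation_le_one_iff, heq]
    exact mul_mem (mul_mem hXV (sub_mem hXV (one_mem V))) (sub_mem hXV hlV)
  -- Since 5 = 4 + 1 and v(4) < 1.
  have v5 : V.valuation 5 = 1 := by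
    have h4 : V.valuation 4 < V.valuation 1 := by
      rw [show (4 : ℂ) = 2 ^ 2 by norm_num, map_pow, map_one]
      exact pow_lt_one₀ zero_le v2 two_ne_zero
    have := Valuation.map_add_eq_of_lt_right V.valuation h4
    rw [map_one, show (4 : ℂ) + 1 = 5 by norm_num] at this
    exact this
  have hnum : 1 ≤ V.valuation (nuX k p.coord ^ 2 - lamC k) := by
    have h1 : V.valuation (nuX k p.coord ^ 2 - lamC k) * V.valuation u = 1 := by
      rw [← map_mul, hu, v5]
    rw [← h1]
    exact mul_le_of_le_one_right' ((V.valuation_le_one_iff _).2 huV)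
  have hbig : 1 < V.valuation (((nuX k p.coord ^ 2 - lamC k) / (2 * nuY k p.coord)) ^ 2) := by
    have hv2 : 0 < V.valuation 2 := zero_lt_iff.2 ((Valuation.ne_zero_iff _).2 h2)
    have hvY : 0 < V.valuation (nuY k p.coord) :=
      zero_lt_iff.2 ((Valuation.ne_zero_iff _).2 hY0)
    rw [map_pow, map_div₀, map_mul, div_pow, mul_pow,
      one_lt_div₀ (mul_pos (pow_pos hv2 2) (pow_pos hvY 2))]
    calc V.valuation 2 ^ 2 * V.valuation (nuY k p.coord) ^ 2 ≤ V.valuation 2 ^ 2 :=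
          mul_le_of_le_one_right' hYV
      _ < 1 := pow_lt_one₀ zero_le v2 two_ne_zero
      _ ≤ _ := one_le_pow₀ hnum
  have hinf := hW.not_isOfFinAddOrder V.valuation v2 h2 ((V.valuation_le_one_iff _).2 hlV) h' hbig
  rw [← hdouble] at hinf
  exact fun h => hinf (h.add h)

theorem nu_vertex_mem_mordellWeil (k : Fin 5) {p : Curve}
    (hp : p ∈ blackPoints ∪ whitePoints) : nu k p ∈ mordellWeil k := by
  obtain ⟨z, hz, hphi, hzk, hX⟩ := exists_nuX_vertex k hp
  obtain ⟨y, hyk, -, hy⟩ := exists_sq_vertexX k hz hphi hzk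
  have hn := nu_nonsingular k p.coord p.2 (coord_ne_zero_of_vertex hp (k - 1))
  rw [nu_eq_some (coord_ne_zero_of_vertex hp (k - 1))]
  have heq := ((isLegendre_E k).equation_iff _ _).1 hn.1
  rw [← hX, ← heq] at hy
  refine some_mem_mordellWeil _ ?_ ?_
  · rw [hX]
    exact mul_mem (phi_mem k) (pow_mem hzk _)
  · rcases sq_eq_sq_iff_eq_or_eq_neg.1 hy with h | h
    · exact h ▸ hyk
    · exact neg_mem_iff.1 (h ▸ hyk)

/-! ### The images of the face centers -/

/-- The squares of the coordinates are five pairwise independent linear forms in x_1² and x_2². Two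
of them vanishing forces x_1 = x_2 = 0, and then all coordinates vanish. -/
theorem coord_eq_zero_unique (p : Curve) {i j : Fin 5} (hi : p.coord i = 0) (hj : p.coord j = 0) :
    i = j := by
  by_contra hij
  obtain ⟨h3, h4, h5⟩ := p.curveEq
  have hphi := phi_mul_sub_one
  have hp0 := phi_ne_zero
  have key : p.coord 1 ^ 2 = 0 ∧ p.coord 2 ^ 2 = 0 := by
    have hi2 : p.coord i ^ 2 = 0 := by rw [hi]; norm_num
    have hj2 : p.coord j ^ 2 = 0 := by rw [hj]; norm_num
    clear hi hj
    have e3 : p.coord 3 ^ 2 = -p.coord 1 ^ 2 - p.coord 2 ^ 2 := by linear_combination h3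
    have e4 : p.coord 4 ^ 2 = -phi * p.coord 1 ^ 2 - p.coord 2 ^ 2 := by linear_combination h4
    have e5 : p.coord 0 ^ 2 = -(1 + phi) * p.coord 1 ^ 2 - p.coord 2 ^ 2 := by
      have h5' : (1 + phi) * p.coord 1 ^ 2 + p.coord 2 ^ 2 + p.coord 0 ^ 2 = 0 := h5
      linear_combination h5'
    clear h3 h4 h5
    rcases fin_five_cases i with rfl | rfl | rfl | rfl | rfl <;>
      rcases fin_five_cases j with rfl | rfl | rfl | rfl | rfl <;>
      first
      | exact absurd rfl hij
      | (try simp only [e3, e4, e5] at hi2 hj2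
         clear e3 e4 e5 hij
         generalize p.coord 1 ^ 2 = a, p.coord 2 ^ 2 = b at *
         grind)
  obtain ⟨k1, k2⟩ := key
  apply p.coord_ne_zero
  funext i
  rw [Pi.zero_apply, ← pow_eq_zero_iff two_ne_zero]
  rcases fin_five_cases i with rfl | rfl | rfl | rfl | rfl
  · change p.coord 5 ^ 2 = 0
    linear_combination h5 - (1 + phi) * k1 - k2
  · exact k1
  · exact k2
  · linear_combination h3 - k1 - k2
  · linear_combination h4 - phi * k1 - k2

/-- The `x`-coordinate of the images of the face centers of order `4`. -/
def fourTorsionX : Fin 5 → ℂ := ![phi + 1, -phi, phi + 1, phi + 1, -phi]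

theorem nuX_of_coord_eq_zero {k : Fin 5} {x : Fin 5 → ℂ} (h : x k = 0) :
    nuX k x = fourTorsionX k := by
  rw [nuX_eq, h, zero_pow two_ne_zero, zero_div, mul_zero, zero_add]
  rfl

theorem exists_sq_fourTorsionX (k : Fin 5) :
    ∃ y ∈ numField k, y ≠ 0 ∧
      y ^ 2 = fourTorsionX k * (fourTorsionX k - 1) * (fourTorsionX k - lamC k) := by
  have hp0 := phi_ne_zero
  have hpk := phi_mem k
  have hphi := phi_sq
  rcases fin_five_cases k with rfl | rfl | rfl | rfl | rfl
  · obtain ⟨s, hs, h⟩ := exists_sq_eq_phi (k := 0) (Or.inl rfl)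
    refine ⟨phi * s, mul_mem hpk hs, mul_ne_zero hp0 ?_, ?_⟩
    · rintro rfl
      exact hp0 (by rw [← h]; norm_num)
    · change (phi * s) ^ 2 = (phi + 1) * (phi + 1 - 1) * (phi + 1 - phi)
      linear_combination phi ^ 2 * h + phi * hphi
  · refine ⟨Complex.I * phi ^ 3, mul_mem (I_mem 1) (pow_mem hpk 3),
      mul_ne_zero Complex.I_ne_zero (pow_ne_zero 3 hp0), ?_⟩
    change (Complex.I * phi ^ 3) ^ 2 = -phi * (-phi - 1) * (-phi - (phi + 1))
    rw [mul_pow, Complex.I_sq]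
    clear hpk hp0
    generalize phi = f at *
    grind
  · obtain ⟨s, hs, h⟩ := exists_sq_eq_phi (k := 2) (Or.inr rfl)
    refine ⟨phi * s, mul_mem hpk hs, mul_ne_zero hp0 ?_, ?_⟩
    · rintro rfl
      exact hp0 (by rw [← h]; norm_num)
    · change (phi * s) ^ 2 = (phi + 1) * (phi + 1 - 1) * (phi + 1 - phi)
      linear_combination phi ^ 2 * h + phi * hphi
  · refine ⟨phi ^ 3, pow_mem hpk 3, pow_ne_zero 3 hp0, ?_⟩
    change (phi ^ 3) ^ 2 = (phi + 1) * (phi + 1 - 1) * (phi + 1 - -phi)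
    clear hpk hp0
    generalize phi = f at *
    grind
  · refine ⟨Complex.I * phi ^ 3, mul_mem (I_mem 4) (pow_mem hpk 3),
      mul_ne_zero Complex.I_ne_zero (pow_ne_zero 3 hp0), ?_⟩
    change (Complex.I * phi ^ 3) ^ 2 = -phi * (-phi - 1) * (-phi - (phi + 1))
    rw [mul_pow, Complex.I_sq]
    clear hpk hp0
    generalize phi = f at *
    grind

theorem fourTorsionX_double (k : Fin 5) :
    (fourTorsionX k ^ 2 - lamC k) ^ 2 = torsionX k *
      (4 * (fourTorsionX k * (fourTorsionX k - 1) * (fourTorsionX k - lamC k))) := by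
  have hphi := phi_sq
  rcases fin_five_cases k with rfl | rfl | rfl | rfl | rfl
  · change ((phi + 1) ^ 2 - phi) ^ 2 = phi * (4 * ((phi + 1) * (phi + 1 - 1) * (phi + 1 - phi)))
    generalize phi = f at *
    grind
  · change ((-phi) ^ 2 - (phi + 1)) ^ 2 = 0 * _
    rw [zero_mul, neg_sq, hphi, sub_self, zero_pow two_ne_zero]
  · change ((phi + 1) ^ 2 - phi) ^ 2 = phi * (4 * ((phi + 1) * (phi + 1 - 1) * (phi + 1 - phi)))
    generalize phi = f at *
    grind
  · change ((phi + 1) ^ 2 - -phi) ^ 2 = 1 * (4 * ((phi + 1) * (phi + 1 - 1) * (phi + 1 - -phi)))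
    generalize phi = f at *
    grind
  · change ((-phi) ^ 2 - (phi + 1)) ^ 2 = 0 * _
    rw [zero_mul, neg_sq, hphi, sub_self, zero_pow two_ne_zero]

section Face

variable {k : Fin 5} {f : Curve}

theorem nu_eq_zero_of_coord (h : f.coord (k - 1) = 0) : nu k f = 0 := dif_pos h

theorem sub_one_ne (k : Fin 5) : k - 1 ≠ k := by
  revert k
  decide

theorem exists_nu_of_coord (h : f.coord k = 0) :
    ∃ y hn, nu k f = .some (fourTorsionX k) y hn := by
  have h0 : f.coord (k - 1) ≠ 0 := fun h' => sub_one_ne k (coord_eq_zero_unique f h' h)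
  rw [nu_eq_some h0]
  have hn := nu_nonsingular k f.coord f.2 h0
  simp only [nuX_of_coord_eq_zero h] at hn ⊢
  exact ⟨_, hn, rfl⟩

/-- The duplication formula gives the x-coordinate `torsionX k`, a root of the cubic, so y = 0 and
no sign ambiguity remains. -/
theorem nu_add_self_of_coord (h : f.coord k = 0) : nu k f + nu k f = twoTorsion k := by
  obtain ⟨y, hn, e⟩ := exists_nu_of_coord h
  have hW := isLegendre_E k
  have heq := (hW.equation_iff _ _).1 hn.1
  obtain ⟨y0, -, hy0, hy⟩ := exists_sq_fourTorsionX k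
  have hne : y ≠ 0 := by
    rintro rfl
    rw [← hy] at heq
    exact pow_ne_zero 2 hy0 (by rw [← heq]; norm_num)
  obtain ⟨y', h', e'⟩ := hW.add_self two_ne_zero hn hne
  have hx : ((fourTorsionX k ^ 2 - lamC k) / (2 * y)) ^ 2 = torsionX k := by
    rw [div_pow, fourTorsionX_double, ← heq]
    field_simp
    ring
  rw [e, e']
  simp only [hx] at h' ⊢
  have h0 := (hW.equation_iff _ _).1 h'.1
  rw [← torsionX_eq k, zero_pow two_ne_zero, pow_eq_zero_iff two_ne_zero] at h0
  subst h0
  rfl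

theorem twoTorsion_ne_zero (k : Fin 5) : twoTorsion k ≠ 0 :=
  WeierstrassCurve.Affine.Point.some_ne_zero _

theorem addOrderOf_nu_of_coord (h : f.coord k = 0) : addOrderOf (nu k f) = 4 := by
  have h2 : 2 • nu k f = twoTorsion k := by rw [two_nsmul, nu_add_self_of_coord h]
  refine addOrderOf_eq_prime_pow (p := 2) (n := 1) ?_ ?_
  · rw [pow_one, h2]
    exact twoTorsion_ne_zero k
  · rw [pow_succ, pow_one, mul_smul, h2, two_nsmul, twoTorsion_add_self]

/-- The vanishing coordinate is one of the three factors in the numerator of the y-coordinate. -/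
theorem exists_nu_of_coord_ne {i : Fin 5} (h : f.coord i = 0) (hi : i ≠ k) (hi' : i ≠ k - 1) :
    ∃ hn, nu k f = .some (nuX k f.coord) 0 hn := by
  have h0 : f.coord (k - 1) ≠ 0 := fun h' => hi' (coord_eq_zero_unique f h h')
  have hn := nu_nonsingular k f.coord f.2 h0
  have hy : nuY k f.coord = 0 := by
    obtain ⟨c, hc⟩ := exists_nuY_eq k
    rw [hc]
    have : i = k + 1 ∨ i = k + 2 ∨ i = k + 3 := by
      clear hc hn h0 h
      revert i k
      decide
    rcases this with rfl | rfl | rfl <;> rw [h] <;> simp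
  rw [nu_eq_some h0]
  simp only [hy] at hn ⊢
  exact ⟨hn, trivial⟩

theorem addOrderOf_nu_of_coord_ne {i : Fin 5} (h : f.coord i = 0) (hi : i ≠ k)
    (hi' : i ≠ k - 1) : addOrderOf (nu k f) = 2 := by
  obtain ⟨hn, e⟩ := exists_nu_of_coord_ne h hi hi'
  have : Fact (Nat.Prime 2) := ⟨Nat.prime_two⟩
  refine addOrderOf_eq_prime ?_ ?_
  · rw [e, two_nsmul, (isLegendre_E k).add_self_eq_zero]
  · rw [e]
    exact WeierstrassCurve.Affine.Point.some_ne_zero _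

/-- The `x`-coordinate of the images of the face centers for the colors `k`, `k + 1`. -/
def secondTorsionX : Fin 5 → ℂ := ![1, 1, 1, 0, 1]

/-- Setting one coordinate to zero fixes the ratio of the squares of any two others. This supplies
the second torsion generator, different from `twoTorsion k` by `secondTorsionX_ne`. -/
theorem nuX_of_coord_add_two (h : f.coord (k + 2) = 0) :
    nuX k f.coord = secondTorsionX k := by
  have h0 : f.coord (k - 1) ≠ 0 := fun h' => by
    have := coord_eq_zero_unique f h h'
    clear h h'
    revert k
    decide
  have hphi := phi_sq
  obtain ⟨h3, h4, h5⟩ := f.curveEq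
  have r : f.coord k ^ 2 / f.coord (k - 1) ^ 2 =
      (![phi, 1 - phi, -phi, 1 - phi, 1] : Fin 5 → ℂ) k := by
    rw [div_eq_iff (pow_ne_zero 2 h0)]
    clear h0
    have h' : f.coord (k + 2) ^ 2 = 0 := by rw [h, zero_pow two_ne_zero]
    clear h
    rcases fin_five_cases k with rfl | rfl | rfl | rfl | rfl
    · change f.coord 5 ^ 2 = phi * f.coord 4 ^ 2
      change f.coord 2 ^ 2 = 0 at h'
      linear_combination h5 - phi * h4 - (1 - phi) * h' + f.coord 1 ^ 2 * hphi
    · change f.coord 1 ^ 2 = (1 - phi) * f.coord 5 ^ 2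
      change f.coord 3 ^ 2 = 0 at h'
      linear_combination (phi - 1) * h5 + (1 - phi) * h3 - (1 - phi) * h' -
        f.coord 1 ^ 2 * hphi
    · change f.coord 2 ^ 2 = -phi * f.coord 1 ^ 2
      change f.coord 4 ^ 2 = 0 at h'
      linear_combination h4 - h'
    · change f.coord 3 ^ 2 = (1 - phi) * f.coord 2 ^ 2
      change f.coord 5 ^ 2 = 0 at h'
      linear_combination h3 - (2 - phi) * h5 + (2 - phi) * h' - f.coord 1 ^ 2 * hphi
    · change f.coord 4 ^ 2 = 1 * f.coord 3 ^ 2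
      change f.coord 1 ^ 2 = 0 at h'
      linear_combination h4 - h3 - (phi - 1) * h'
  rw [nuX_eq, r]
  clear r h h0 h3 h4 h5
  rcases fin_five_cases k with rfl | rfl | rfl | rfl | rfl
  · change -1 * phi + (phi + 1) = 1
    ring
  · change -(2 * phi + 1) * (1 - phi) + -phi = 1
    linear_combination 2 * hphi
  · change 1 * -phi + (phi + 1) = 1
    ring
  · change (2 * phi + 1) * (1 - phi) + (phi + 1) = 0
    linear_combination -2 * hphi
  · change (phi + 1) * 1 + -phi = 1
    ring

theorem add_two_ne (k : Fin 5) : k + 2 ≠ k ∧ k + 2 ≠ k - 1 := by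
  revert k
  decide

theorem exists_nu_of_coord_add_two (h : f.coord (k + 2) = 0) :
    ∃ hn, nu k f = .some (secondTorsionX k) 0 hn := by
  obtain ⟨hn, e⟩ := exists_nu_of_coord_ne h (add_two_ne k).1 (add_two_ne k).2
  rw [e]
  simp only [nuX_of_coord_add_two h] at hn ⊢
  exact ⟨hn, trivial⟩

theorem secondTorsionX_ne (k : Fin 5) : secondTorsionX k ≠ torsionX k := by
  have hphi := phi_mul_sub_one
  have h1 : (1 : ℂ) ≠ phi := by
    intro h
    rw [← h] at hphi
    norm_num at hphi
  rcases fin_five_cases k with rfl | rfl | rfl | rfl | rfl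
  · exact h1
  · exact one_ne_zero
  · exact h1
  · exact zero_ne_one
  · exact one_ne_zero

/-- Every point of order `2` is a combination of two of them. -/
theorem two_torsion_cases {x : ℂ} (hn : ((E k).baseChange ℂ).toAffine.Nonsingular x 0)
    (hu : ((E k).baseChange ℂ).toAffine.Nonsingular (secondTorsionX k) 0) :
    (.some x 0 hn : EPoint k) = twoTorsion k ∨ (.some x 0 hn : EPoint k) = .some _ 0 hu ∨
      (.some x 0 hn : EPoint k) = .some _ 0 hu + twoTorsion k := by
  have hW := isLegendre_E k
  have heq := (hW.equation_iff _ _).1 hn.1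
  by_cases h1 : x = torsionX k
  · subst h1
    exact Or.inl rfl
  by_cases h2 : x = secondTorsionX k
  · subst h2
    exact Or.inr (Or.inl rfl)
  refine Or.inr (Or.inr ?_)
  refine (hW.add_two_torsion hu (nonsingular_E (torsionX_eq k)) hn (secondTorsionX_ne k) ?_
    (by ring)).symm
  have hphi := phi_sq
  -- The derivative of a monic cubic at a root is the product of the differences to the other two
  -- roots, so the sum of two distinct points of order 2 is the third one.
  rw [torsionX_deriv]
  rw [zero_pow two_ne_zero] at heq
  have h3 := mul_eq_zero.1 heq.symm
  rw [mul_eq_zero] at h3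
  clear hn hu heq hW
  rcases fin_five_cases k with rfl | rfl | rfl | rfl | rfl
  · change (x - phi) * (1 - phi) = 1
    change ¬ x = phi at h1
    change ¬ x = 1 at h2
    change (x = 0 ∨ x - 1 = 0) ∨ x - phi = 0 at h3
    rcases h3 with (h3 | h3) | h3
    · rw [h3]
      linear_combination hphi
    · exact absurd (sub_eq_zero.1 h3) h2
    · exact absurd (sub_eq_zero.1 h3) h1
  · change (x - 0) * (1 - 0) = phi ^ 2
    change ¬ x = 0 at h1
    change ¬ x = 1 at h2
    change (x = 0 ∨ x - 1 = 0) ∨ x - (phi + 1) = 0 at h3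
    rcases h3 with (h3 | h3) | h3
    · exact absurd h3 h1
    · exact absurd (sub_eq_zero.1 h3) h2
    · linear_combination h3 - hphi
  · change (x - phi) * (1 - phi) = 1
    change ¬ x = phi at h1
    change ¬ x = 1 at h2
    change (x = 0 ∨ x - 1 = 0) ∨ x - phi = 0 at h3
    rcases h3 with (h3 | h3) | h3
    · rw [h3]
      linear_combination hphi
    · exact absurd (sub_eq_zero.1 h3) h2
    · exact absurd (sub_eq_zero.1 h3) h1
  · change (x - 1) * (0 - 1) = phi ^ 2
    change ¬ x = 1 at h1
    change ¬ x = 0 at h2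
    change (x = 0 ∨ x - 1 = 0) ∨ x - -phi = 0 at h3
    rcases h3 with (h3 | h3) | h3
    · exact absurd h3 h2
    · exact absurd (sub_eq_zero.1 h3) h1
    · linear_combination -h3 - hphi
  · change (x - 0) * (1 - 0) = phi ^ 2
    change ¬ x = 0 at h1
    change ¬ x = 1 at h2
    change (x = 0 ∨ x - 1 = 0) ∨ x - (phi + 1) = 0 at h3
    rcases h3 with (h3 | h3) | h3
    · exact absurd h3 h1
    · exact absurd (sub_eq_zero.1 h3) h2
    · linear_combination h3 - hphi

/-- The images of the face centers are combinations of two of them. -/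
theorem nu_face_eq {g e : Curve} {i : Fin 5} (hf : f.coord i = 0) (hg : g.coord k = 0)
    (he : e.coord (k + 2) = 0) : ∃ a b : ℤ, nu k f = a • nu k g + b • nu k e := by
  by_cases h1 : i = k - 1
  · exact ⟨0, 0, by rw [nu_eq_zero_of_coord (h1 ▸ hf), zero_zsmul, zero_zsmul, add_zero]⟩
  by_cases h2 : i = k
  · obtain ⟨y, hn, e1⟩ := exists_nu_of_coord (h2 ▸ hf)
    obtain ⟨y', hn', e2⟩ := exists_nu_of_coord hg
    rcases (isLegendre_E k).eq_or_eq_neg hn hn' with h | h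
    · exact ⟨1, 0, by rw [e1, e2, h, zero_zsmul, one_zsmul, add_zero]⟩
    · exact ⟨-1, 0, by rw [e1, e2, h, zero_zsmul, neg_zsmul, one_zsmul, add_zero]⟩
  · obtain ⟨hn, e1⟩ := exists_nu_of_coord_ne hf h2 h1
    obtain ⟨hu, e2⟩ := exists_nu_of_coord_add_two he
    have e3 : (2 : ℤ) • nu k g = twoTorsion k := by rw [two_zsmul, nu_add_self_of_coord hg]
    rcases two_torsion_cases hn hu with h | h | h
    · exact ⟨2, 0, by rw [e1, h, e3, zero_zsmul, add_zero]⟩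
    · exact ⟨0, 1, by rw [e1, e2, h, one_zsmul, zero_zsmul, zero_add]⟩
    · exact ⟨2, 1, by rw [e1, e2, h, one_zsmul, e3, add_comm]⟩

theorem nu_face_mem_mordellWeil {g e : Curve} {i : Fin 5} (hf : f.coord i = 0)
    (hg : g.coord k = 0) (he : e.coord (k + 2) = 0) : nu k f ∈ mordellWeil k := by
  obtain ⟨a, b, h⟩ := nu_face_eq hf hg he
  rw [h]
  refine add_mem (zsmul_mem ?_ a) (zsmul_mem ?_ b)
  · obtain ⟨y', hn, e1⟩ := exists_nu_of_coord hg
    obtain ⟨y, hyk, -, hy⟩ := exists_sq_fourTorsionX k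
    rw [e1]
    refine some_mem_mordellWeil hn ?_ ?_
    · rcases fin_five_cases k with rfl | rfl | rfl | rfl | rfl
      · exact add_mem (phi_mem 0) (one_mem _)
      · exact neg_mem (phi_mem 1)
      · exact add_mem (phi_mem 2) (one_mem _)
      · exact add_mem (phi_mem 3) (one_mem _)
      · exact neg_mem (phi_mem 4)
    · rw [← ((isLegendre_E k).equation_iff _ _).1 hn.1] at hy
      rcases sq_eq_sq_iff_eq_or_eq_neg.1 hy with h | h
      · exact h ▸ hyk
      · exact neg_mem_iff.1 (h ▸ hyk)
  · obtain ⟨hu, e2⟩ := exists_nu_of_coord_add_two he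
    rw [e2]
    refine some_mem_mordellWeil hu ?_ (zero_mem _)
    rcases fin_five_cases k with rfl | rfl | rfl | rfl | rfl
    · exact one_mem _
    · exact one_mem _
    · exact one_mem _
    · exact zero_mem _
    · exact one_mem _

end Face

/-! ### Existence of embeddings -/

/-- The sign `(-1)^a`. -/
def signOf (a : ZMod 2) : ℂ := (-1) ^ a.val

theorem zmod_two_cases (a : ZMod 2) : a = 0 ∨ a = 1 := by
  revert a
  decide

theorem signOf_zero : signOf 0 = 1 := pow_zero _

theorem signOf_one : signOf 1 = -1 := pow_one _

theorem signOf_add (a b : ZMod 2) : signOf (a + b) = signOf a * signOf b := by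
  rcases zmod_two_cases a with rfl | rfl <;> rcases zmod_two_cases b with rfl | rfl <;>
    simp [signOf_zero, signOf_one, show (1 + 1 : ZMod 2) = 0 from rfl]

theorem signOf_sq (a : ZMod 2) : signOf a ^ 2 = 1 := by
  rcases zmod_two_cases a with rfl | rfl <;> simp [signOf_zero, signOf_one]

theorem signOf_ne_zero (a : ZMod 2) : signOf a ≠ 0 := by
  rcases zmod_two_cases a with rfl | rfl <;> simp [signOf_zero, signOf_one]

theorem signOf_injective : Function.Injective signOf := by
  intro a b h
  rcases zmod_two_cases a with rfl | rfl <;> rcases zmod_two_cases b with rfl | rfl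
  · rfl
  · rw [signOf_zero, signOf_one] at h
    norm_num at h
  · rw [signOf_zero, signOf_one] at h
    norm_num at h
  · rfl

/-- The sign of the `i`-th coordinate, relative to a common power of `ζ`, that is picked up along
an edge of color `j`. -/
def edgeFlip (j i : Fin 5) : ZMod 2 :=
  if ((j : ℕ) + 4 - i) % 5 ≤ 2 ↔ (j : ℕ) + 4 - i < 5 then 0 else 1

/-- The first factor is common to all coordinates and drops out projectively; the second does not
depend on the color. So edges of different colors at one black point differ only in signs. -/
theorem zeta_pow_edgeExp (j i : Fin 5) :
    zeta ^ edgeExp j i = zeta ^ ((j : ℕ) + 4) * (zeta ^ (10 - (i : ℕ)) * signOf (edgeFlip j i)) := by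
  have h : edgeExp j i % 10 = ((j : ℕ) + 4 + (10 - i) + 5 * (edgeFlip j i).val) % 10 := by
    revert j i
    decide
  rw [zeta_pow_mod, h, ← zeta_pow_mod, pow_add, pow_add, pow_mul, zeta_pow_five, signOf, mul_assoc]

/-- The squares of the coordinates of a black point. -/
def IsBlackVector (x : Fin 5 → ℂ) : Prop := x 1 ≠ 0 ∧ ∀ i, x i ^ 2 = sqCoeff i * x 1 ^ 2

theorem IsBlackVector.ne_zero {x : Fin 5 → ℂ} (hx : IsBlackVector x) (i : Fin 5) : x i ≠ 0 := by
  intro h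
  have := hx.2 i
  rw [h, zero_pow two_ne_zero] at this
  exact mul_ne_zero (sqCoeff_ne_zero i) (pow_ne_zero 2 hx.1) this.symm

/-- The coordinates of the vertex that is reached from `x` along edges whose colors are the support
of `w`; for `a = 1` the starting vertex is the white point that belongs to `x`. -/
def vertexVector (x : Fin 5 → ℂ) (a : ZMod 2) (w : Fin 5 → ZMod 2) : Fin 5 → ℂ := fun i =>
  x i * zeta ^ ((a + ∑ j, w j).val * (10 - (i : ℕ))) * signOf (∑ j, w j * edgeFlip j i)

theorem IsBlackVector.vertexVector_ne_zero {x : Fin 5 → ℂ} (hx : IsBlackVector x) (a : ZMod 2)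
    (w : Fin 5 → ZMod 2) (i : Fin 5) : vertexVector x a w i ≠ 0 :=
  mul_ne_zero (mul_ne_zero (hx.ne_zero i) (pow_ne_zero _ zeta_ne_zero)) (signOf_ne_zero _)

theorem vertexVector_sq (x : Fin 5 → ℂ) (a : ZMod 2) (w : Fin 5 → ZMod 2) (i : Fin 5) :
    vertexVector x a w i ^ 2 = x i ^ 2 * zeta ^ ((a + ∑ j, w j).val * (20 - 2 * (i : ℕ))) := by
  rw [vertexVector, mul_pow, signOf_sq, mul_one, mul_pow, ← pow_mul, mul_assoc]
  congr 3
  omega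

theorem IsBlackVector.curveEq {x : Fin 5 → ℂ} (hx : IsBlackVector x) (a : ZMod 2)
    (w : Fin 5 → ZMod 2) : CurveEq (vertexVector x a w) := by
  rcases zmod_two_cases (a + ∑ j, w j) with h | h
  · refine curveEq_of_sq (α := x 1 ^ 2) (β := 0) fun i => ?_
    rw [vertexVector_sq, h, hx.2 i, ZMod.val_zero, zero_mul, pow_zero]
    ring
  · refine curveEq_of_sq (α := 0) (β := -x 1 ^ 2 * zeta ^ 7) fun i => ?_
    rw [vertexVector_sq, h, hx.2 i, ZMod.val_one, one_mul,
      show 20 - 2 * (i : ℕ) = 7 + (13 - 2 * (i : ℕ)) by omega, pow_add]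
    ring

/-- The vertex with coordinates `vertexVector x a w`. -/
def IsBlackVector.vertex {x : Fin 5 → ℂ} (hx : IsBlackVector x) (a : ZMod 2)
    (w : Fin 5 → ZMod 2) : Curve :=
  Curve.mk (vertexVector x a w) (fun h => hx.vertexVector_ne_zero a w 0 (congrFun h 0))
    (hx.curveEq a w)

theorem IsBlackVector.exists_coord {x : Fin 5 → ℂ} (hx : IsBlackVector x) (a : ZMod 2)
    (w : Fin 5 → ZMod 2) : ∃ b : ℂ, b ≠ 0 ∧ (hx.vertex a w).coord = b • vertexVector x a w :=
  Curve.exists_coord_mk _ _ _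

theorem IsBlackVector.of_vertexVector {x : Fin 5 → ℂ} (hx : IsBlackVector x) {a : ZMod 2}
    {w : Fin 5 → ZMod 2} (h : a + ∑ j, w j = 0) : IsBlackVector (vertexVector x a w) := by
  refine ⟨hx.vertexVector_ne_zero a w 1, fun i => ?_⟩
  rw [vertexVector_sq, vertexVector_sq, h, hx.2 i, ZMod.val_zero, zero_mul, zero_mul, pow_zero,
    mul_one, mul_one]

theorem IsBlackVector.vertex_mem_black {x : Fin 5 → ℂ} (hx : IsBlackVector x) {a : ZMod 2}
    {w : Fin 5 → ZMod 2} (h : a + ∑ j, w j = 0) : hx.vertex a w ∈ blackPoints := by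
  obtain ⟨b, hb, e⟩ := hx.exists_coord a w
  obtain ⟨h1, h2⟩ := hx.of_vertexVector h
  rw [mem_blackPoints, e]
  refine ⟨mul_ne_zero hb h1, fun i => ?_⟩
  simp only [Pi.smul_apply, smul_eq_mul, mul_pow, h2 i]
  ring

theorem IsBlackVector.vertex_mem_white {x : Fin 5 → ℂ} (hx : IsBlackVector x) {a : ZMod 2}
    {w : Fin 5 → ZMod 2} (h : a + ∑ j, w j = 1) : hx.vertex a w ∈ whitePoints := by
  obtain ⟨b, hb, e⟩ := hx.exists_coord a w
  rw [mem_whitePoints, e]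
  refine ⟨mul_ne_zero hb (hx.vertexVector_ne_zero a w 1), fun i => ?_⟩
  simp only [Pi.smul_apply, smul_eq_mul, mul_pow, vertexVector_sq, hx.2 i, h, ZMod.val_one,
    one_mul]
  have : zeta ^ (20 - 2 * (i : ℕ)) =
      zeta ^ (12 - 2 * (i : ℕ)) * zeta ^ (20 - 2 * ((1 : Fin 5) : ℕ)) := by
    rw [← pow_add, zeta_pow_mod, zeta_pow_mod (12 - 2 * (i : ℕ) + (20 - 2 * ((1 : Fin 5) : ℕ)))]
    congr 1
    clear * -
    revert i
    decide
  rw [this]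
  ring

theorem not_black_of_white {p : Curve} (hb : p ∈ blackPoints) (hw : p ∈ whitePoints) : False := by
  obtain ⟨h1, h2⟩ := mem_blackPoints.1 hb
  obtain ⟨-, h3⟩ := mem_whitePoints.1 hw
  have h4 := h3 2
  rw [h2 2] at h4
  have h5 : sqCoeff 2 * p.coord 1 ^ 2 * (1 - zeta ^ 8) = 0 := by
    have h4' : sqCoeff 2 * p.coord 1 ^ 2 = sqCoeff 2 * zeta ^ 8 * p.coord 1 ^ 2 := h4
    linear_combination h4'
  have h8 := (mul_eq_zero.1 h5).resolve_left
    (mul_ne_zero (sqCoeff_ne_zero 2) (pow_ne_zero 2 h1))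
  apply zeta_sq_ne_one
  linear_combination zeta_pow_ten + zeta ^ 2 * h8

/-- Paths with the same flips, up to a global sign, and the same parity coincide. -/
theorem eq_zero_of_edgeFlip (d : Fin 5 → ZMod 2) (h0 : ∑ j, d j = 0)
    (h : ∀ i, ∑ j, d j * edgeFlip j i = ∑ j, d j * edgeFlip j 0) : d = 0 := by
  -- The sign patterns of the five colors, modulo a global sign and together with the parity
  -- condition, are independent over 𝔽₂; there are only 32 vectors to check.
  have key : ∀ d0 d1 d2 d3 d4 : ZMod 2, d0 + d1 + d2 + d3 + d4 = 0 →
      (∀ i, d0 * edgeFlip 0 i + d1 * edgeFlip 1 i + d2 * edgeFlip 2 i + d3 * edgeFlip 3 i +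
        d4 * edgeFlip 4 i = d0 * edgeFlip 0 0 + d1 * edgeFlip 1 0 + d2 * edgeFlip 2 0 +
        d3 * edgeFlip 3 0 + d4 * edgeFlip 4 0) →
      d0 = 0 ∧ d1 = 0 ∧ d2 = 0 ∧ d3 = 0 ∧ d4 = 0 := by
    decide
  simp only [Fin.sum_univ_five] at h0 h
  obtain ⟨h0, h1, h2, h3, h4⟩ := key _ _ _ _ _ h0 h
  funext j
  fin_cases j <;> assumption

/-- The parity is determined because black and white fibres are disjoint. Within one class, equal
projective points have sign patterns that differ by one scalar, hence by one global sign. -/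
theorem IsBlackVector.vertex_injective {x : Fin 5 → ℂ} (hx : IsBlackVector x) (a : ZMod 2) :
    Function.Injective (hx.vertex a) := by
  intro w w' h
  have hs : a + ∑ j, w j = a + ∑ j, w' j := by
    rcases zmod_two_cases (a + ∑ j, w j) with h1 | h1 <;>
      rcases zmod_two_cases (a + ∑ j, w' j) with h2 | h2
    · rw [h1, h2]
    · exact (not_black_of_white (hx.vertex_mem_black h1) (h ▸ hx.vertex_mem_white h2)).elim
    · exact (not_black_of_white (hx.vertex_mem_black h2) (h ▸ hx.vertex_mem_white h1)).elim
    · rw [h1, h2]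
  obtain ⟨b, hb, e⟩ := hx.exists_coord a w
  obtain ⟨b', hb', e'⟩ := hx.exists_coord a w'
  have hc : b • vertexVector x a w = b' • vertexVector x a w' := by rw [← e, ← e', h]
  have hsign : ∀ i, b * signOf (∑ j, w j * edgeFlip j i) =
      b' * signOf (∑ j, w' j * edgeFlip j i) := by
    intro i
    have := congrFun hc i
    simp only [Pi.smul_apply, smul_eq_mul, vertexVector, hs] at this
    have hne : x i * zeta ^ ((a + ∑ j, w' j).val * (10 - (i : ℕ))) ≠ 0 :=
      mul_ne_zero (hx.ne_zero i) (pow_ne_zero _ zeta_ne_zero)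
    apply mul_left_cancel₀ hne
    linear_combination this
  have hd : ∀ i, signOf (∑ j, (w j + w' j) * edgeFlip j i) = b' / b := by
    intro i
    have e1 : ∑ j, (w j + w' j) * edgeFlip j i =
        ∑ j, w j * edgeFlip j i + ∑ j, w' j * edgeFlip j i := by
      rw [← Finset.sum_add_distrib]
      exact Finset.sum_congr rfl fun j _ => add_mul _ _ _
    rw [e1, signOf_add, eq_div_iff hb]
    have := signOf_sq (∑ j, w' j * edgeFlip j i)
    linear_combination signOf (∑ j, w' j * edgeFlip j i) * hsign i + b' * this
  have hzero := eq_zero_of_edgeFlip (fun j => w j + w' j)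
    (by
      rw [Finset.sum_add_distrib, add_left_cancel hs]
      exact CharTwo.add_self_eq_zero _)
    (fun i => signOf_injective ((hd i).trans (hd 0).symm))
  funext j
  exact CharTwo.add_eq_zero.1 (congrFun hzero j)

theorem acrossEdge_vertexVector (x : Fin 5 → ℂ) {a : ZMod 2} {w : Fin 5 → ZMod 2}
    (h : a + ∑ j, w j = 0) (j : Fin 5) :
    acrossEdge j (vertexVector x a w) =
      zeta ^ ((j : ℕ) + 4) • vertexVector x a (w + Pi.single j 1) := by
  funext i
  have h1 : a + ∑ l, (w + Pi.single j 1 : Fin 5 → ZMod 2) l = 1 := by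
    simp only [Pi.add_apply]
    rw [Finset.sum_add_distrib, ← add_assoc, h, zero_add, Finset.sum_pi_single']
    simp
  have h2 : ∑ l, (w + Pi.single j 1 : Fin 5 → ZMod 2) l * edgeFlip l i =
      ∑ l, w l * edgeFlip l i + edgeFlip j i := by
    simp only [Pi.add_apply, add_mul]
    rw [Finset.sum_add_distrib]
    congr 1
    simp [Pi.single_apply]
  rw [acrossEdge, Pi.smul_apply, smul_eq_mul, vertexVector, vertexVector, h, h1, h2, ZMod.val_zero,
    ZMod.val_one, zeta_pow_edgeExp, signOf_add]
  ring

theorem IsBlackVector.exists_edge_of_black {x : Fin 5 → ℂ} (hx : IsBlackVector x) {a : ZMod 2}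
    {w : Fin 5 → ZMod 2} (h : a + ∑ j, w j = 0) (j : Fin 5) :
    ∃ e ∈ edges j, hx.vertex a w ∈ closure e ∧ hx.vertex a (w + Pi.single j 1) ∈ closure e := by
  obtain ⟨b, hb, e⟩ := hx.exists_coord a w
  obtain ⟨b', hb', e'⟩ := hx.exists_coord a (w + Pi.single j 1)
  obtain ⟨h1, h2⟩ := hx.of_vertexVector h
  refine exists_edge j (b := b' / zeta ^ ((j : ℕ) + 4)) h1 h2 e ?_
  rw [acrossEdge_vertexVector x h, smul_smul, div_mul_cancel₀ _ (pow_ne_zero _ zeta_ne_zero), e']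

theorem IsBlackVector.exists_edge {x : Fin 5 → ℂ} (hx : IsBlackVector x) (a : ZMod 2)
    (w : Fin 5 → ZMod 2) (j : Fin 5) :
    ∃ e ∈ edges j, hx.vertex a w ∈ closure e ∧ hx.vertex a (w + Pi.single j 1) ∈ closure e := by
  rcases zmod_two_cases (a + ∑ j, w j) with h | h
  · exact hx.exists_edge_of_black h j
  · have h' : a + ∑ l, (w + Pi.single j 1 : Fin 5 → ZMod 2) l = 0 := by
      simp only [Pi.add_apply]
      rw [Finset.sum_add_distrib, ← add_assoc, h, Finset.sum_pi_single']
      simp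
      rfl
    obtain ⟨e, he, h1, h2⟩ := hx.exists_edge_of_black h' j
    have hw : w + Pi.single j 1 + Pi.single j 1 = w := by
      rw [add_assoc]
      convert add_zero w
      funext l
      exact CharTwo.add_self_eq_zero _
    rw [hw] at h2
    exact ⟨e, he, h2, h1⟩

/-- Adding 1 makes the support empty at (1, 1, 1, 1, 1), which thus becomes the base vertex; it is
black for a = 0 and white for a = 1. -/
theorem IsBlackVector.isAdinkraEmbedding {x : Fin 5 → ℂ} (hx : IsBlackVector x) (a : ZMod 2)
    (ρ : Rainbow) : IsAdinkraEmbedding ρ fun u => hx.vertex a fun j => u (ρ j) + 1 where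
  injective u u' h := by
    funext c
    have := congrFun (hx.vertex_injective a h) (ρ.symm c)
    simpa using this
  mem_vertices u := by
    rcases zmod_two_cases (a + ∑ j, (u (ρ j) + 1)) with h | h
    · exact Or.inl (hx.vertex_mem_black h)
    · exact Or.inr (hx.vertex_mem_white h)
  edge u j := by
    have : (fun l => step u (ρ j) (ρ l) + 1) = (fun l => u (ρ l) + 1) + Pi.single j 1 := by
      funext l
      simp only [step, Pi.add_apply, Pi.single_apply, ρ.injective.eq_iff]
      ring
    simp only [this]
    exact hx.exists_edge a _ j

/-- Every black or white point is the image of the vertex `(1, 1, 1, 1, 1)` under an embedding. -/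
theorem exists_isAdinkraEmbedding (ρ : Rainbow) {p : Curve} (hp : p ∈ blackPoints ∪ whitePoints) :
    ∃ ι, IsAdinkraEmbedding ρ ι ∧ ι 1 = p := by
  have one : (fun j => (1 : Vertex) (ρ j) + 1) = 0 := by
    funext j
    exact CharTwo.add_self_eq_zero _
  rcases hp with hp | hp
  · have hx : IsBlackVector p.coord := mem_blackPoints.1 hp
    refine ⟨_, hx.isAdinkraEmbedding 0 ρ, ?_⟩
    obtain ⟨b, hb, e⟩ := hx.exists_coord 0 0
    simp only [one]
    refine Curve.eq_of_coord (a := b) (e.trans ?_)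
    congr 1
    funext i
    simp [vertexVector, signOf_zero]
  · obtain ⟨h1, h2⟩ := mem_whitePoints.1 hp
    -- For odd parity `vertexVector` multiplies coordinate i by ζ^(10-i), so the factor ζ^i is what
    -- makes the base vertex equal to p.
    have hx : IsBlackVector fun i => p.coord i * zeta ^ (i : ℕ) := by
      refine ⟨mul_ne_zero h1 (pow_ne_zero _ zeta_ne_zero), fun i => ?_⟩
      have e : zeta ^ (12 - 2 * (i : ℕ)) * (zeta ^ (i : ℕ)) ^ 2 =
          (zeta ^ ((1 : Fin 5) : ℕ)) ^ 2 := by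
        rw [← pow_mul, ← pow_mul, ← pow_add, zeta_pow_mod, zeta_pow_mod (((1 : Fin 5) : ℕ) * 2)]
        congr 1
        clear * -
        revert i
        decide
      rw [mul_pow, mul_pow, h2 i, ← e]
      ring
    refine ⟨_, hx.isAdinkraEmbedding 1 ρ, ?_⟩
    obtain ⟨b, hb, e⟩ := hx.exists_coord 1 0
    simp only [one]
    refine Curve.eq_of_coord (a := b) (e.trans ?_)
    congr 1
    funext i
    have e : zeta ^ (i : ℕ) * zeta ^ (10 - (i : ℕ)) = 1 := by
      rw [← pow_add, show (i : ℕ) + (10 - i) = 10 by omega, zeta_pow_ten]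
    simp only [vertexVector, Pi.zero_apply, zero_mul, Finset.sum_const_zero, signOf_zero, add_zero,
      ZMod.val_one, one_mul, mul_one]
    rw [mul_assoc, e, mul_one]

/-! ### Signs along walks, transported to E_k -/

theorem IsAdinkraEmbedding.nu_step {ρ : Rainbow} {ι : Vertex → Curve}
    (h : IsAdinkraEmbedding ρ ι) (k : Fin 5) (u : Vertex) (c : Fin 5) :
    nu k (ι (step u c)) = edgeSign k (ρ.symm c) • nu k (ι u) + twoTorsion k := by
  obtain ⟨e, he, h1, h2⟩ := h.edge u (ρ.symm c)
  rw [ρ.apply_symm_apply] at h2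
  refine nu_edge k he h1 h2 (h.mem_vertices _) (h.mem_vertices _) fun heq => ?_
  have := congrFun (h.injective heq) c
  simp [step] at this

theorem edgeSign_symm (ρ : Rainbow) (k c : Fin 5) :
    edgeSign k (ρ.symm c) = -(-1) ^ splitCount ρ k [c] := by
  have h1 : splitCount ρ k [c] = if c = ρ k ∨ c = ρ (k + 2) then 1 else 0 := by
    simp [splitCount, List.countP_cons]
  rw [h1, edgeSign]
  simp only [Equiv.symm_apply_eq]
  split_ifs <;> rfl

/-- The image of the end of a path of an embedded hypercube. -/
theorem IsAdinkraEmbedding.nu_walkEnd {ρ : Rainbow} {ι : Vertex → Curve}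
    (h : IsAdinkraEmbedding ρ ι) (k : Fin 5) (v : Vertex) (l : List (Fin 5)) :
    ∃ a : ℤ, nu k (ι (walkEnd v l)) =
      ((-1) ^ l.length * (-1) ^ splitCount ρ k l : ℤ) • nu k (ι v) + a • twoTorsion k := by
  induction l using List.reverseRecOn with
  | nil => exact ⟨0, by simp [walkEnd, splitCount]⟩
  | append_singleton l c ih =>
    obtain ⟨a, ha⟩ := ih
    refine ⟨a * edgeSign k (ρ.symm c) + 1, ?_⟩
    have e : splitCount ρ k (l ++ [c]) = splitCount ρ k l + splitCount ρ k [c] :=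
      List.countP_append
    have e1 : walkEnd v (l ++ [c]) = step (walkEnd v l) c := walkEnd_append v l [c]
    rw [e1, h.nu_step, ha, e, List.length_append, List.length_singleton, zsmul_add, ← mul_zsmul',
      ← mul_zsmul', add_zsmul, one_zsmul, add_assoc]
    congr 2
    rw [edgeSign_symm]
    ring

end AdinkraH5

end

/-! ### The main theorem -/

open AdinkraH5 in
theorem mainTheorem2 (ρ : AdinkraH5.Rainbow) :
    (∀ p ∈ AdinkraH5.blackPoints ∪ AdinkraH5.whitePoints,
      ∃ ι, AdinkraH5.IsAdinkraEmbedding ρ ι ∧ ι 1 = p) ∧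
    ∀ ι : AdinkraH5.Vertex → AdinkraH5.Curve, AdinkraH5.IsAdinkraEmbedding ρ ι →
      ∀ k : Fin 5,
        AdinkraH5.imageGroup ι k ≤ AdinkraH5.mordellWeil k ∧
        (∃ Φ : AdinkraH5.imageGroup ι k ≃+ ℤ × ZMod 4 × ZMod 2, ∀ u : AdinkraH5.Vertex,
          (Φ ⟨AdinkraH5.nu k (ι u), AdinkraH5.nu_vertex_mem ι k u⟩).1 =
            AdinkraH5.bipartiteSign 1 u * AdinkraH5.colorSplit ρ k 1 u) ∧
        (∀ P : AdinkraH5.EPoint k, P ∈ AdinkraH5.imageGroup ι k ∧ IsOfFinAddOrder P ↔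
          P ∈ AddSubgroup.closure (AdinkraH5.faceImages k)) ∧
        (∀ f ∈ AdinkraH5.faceCenters (k + 2), AdinkraH5.nu k f = 0) ∧
        (∀ f ∈ AdinkraH5.faceCenters (k - 2), addOrderOf (AdinkraH5.nu k f) = 4) ∧
        ∀ j : Fin 5, j ≠ k + 2 → j ≠ k - 2 →
          ∀ f ∈ AdinkraH5.faceCenters j, addOrderOf (AdinkraH5.nu k f) = 2 := by
  refine ⟨fun p hp => exists_isAdinkraEmbedding ρ hp, fun ι h k => ?_⟩
  -- The face center g has coordinate k equal to zero and gives T of order 4; e has coordinate k + 2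
  -- equal to zero and gives U of order 2.
  obtain ⟨g, hg⟩ := faceCenters_nonempty (k - 2)
  obtain ⟨e, he⟩ := faceCenters_nonempty k
  have hg' : g.coord k = 0 := by
    have := coord_eq_zero_of_mem_faceCenters hg
    rwa [sub_add_cancel] at this
  have he' : e.coord (k + 2) = 0 := coord_eq_zero_of_mem_faceCenters he
  have h2g : 2 • nu k g = twoTorsion k := by rw [two_nsmul, nu_add_self_of_coord hg']
  obtain ⟨hu, eu⟩ := exists_nu_of_coord_add_two he'
  have face : ∀ Q ∈ faceImages k, ∃ a b : ℤ, Q = a • nu k g + b • nu k e := by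
    rintro Q ⟨j, f, hf, rfl⟩
    exact nu_face_eq (coord_eq_zero_of_mem_faceCenters hf) hg' he'
  have vert : ∀ u, ∃ a : ℤ, nu k (ι u) =
      (bipartiteSign 1 u * colorSplit ρ k 1 u) • nu k (ι 1) + a • nu k g := by
    intro u
    obtain ⟨l, rfl⟩ := exists_walkEnd_eq 1 u
    obtain ⟨a, ha⟩ := h.nu_walkEnd k 1 l
    -- The 2-torsion point collected along the walk is 2T.
    refine ⟨a * 2, ?_⟩
    rw [ha, colorSplit_walkEnd, bipartiteSign_walkEnd, mul_zsmul _ a 2, two_zsmul, ← two_nsmul, h2g]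
  obtain ⟨⟨Φ, hΦ⟩, tors⟩ := exists_addEquiv_closure (P := nu k (ι 1)) (T := nu k g) (U := nu k e)
    (by rw [show 4 = 2 * 2 from rfl, mul_nsmul, h2g, two_nsmul, twoTorsion_add_self])
    (by rw [eu, two_nsmul, (isLegendre_E k).add_self_eq_zero])
    (nu_vertex_not_isOfFinAddOrder k (h.mem_vertices 1))
    (by rw [h2g]; exact twoTorsion_ne_zero k)
    (by rw [eu]; exact WeierstrassCurve.Affine.Point.some_ne_zero _)
    (by
      rw [h2g, eu, twoTorsion]
      intro h
      rw [WeierstrassCurve.Affine.Point.some.injEq] at h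
      exact secondTorsionX_ne k h.1)
    (fun u => nu k (ι u)) _ vert ⟨1, rfl⟩ (S := faceImages k) ⟨_, g, hg, rfl⟩ ⟨_, e, he, rfl⟩ face
  refine ⟨?_, ⟨Φ, fun u => hΦ u _⟩, tors, ?_, ?_, ?_⟩
  · refine (AddSubgroup.closure_le _).2 ?_
    rintro Q (⟨u, rfl⟩ | ⟨j, f, hf, rfl⟩)
    · exact nu_vertex_mem_mordellWeil k (h.mem_vertices u)
    · exact nu_face_mem_mordellWeil (coord_eq_zero_of_mem_faceCenters hf) hg' he'
  · intro f hf
    apply nu_eq_zero_of_coord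
    have e : k + 2 + 2 = k - 1 := by
      clear * -
      revert k
      decide
    exact e ▸ coord_eq_zero_of_mem_faceCenters hf
  · intro f hf
    apply addOrderOf_nu_of_coord
    have := coord_eq_zero_of_mem_faceCenters hf
    rwa [sub_add_cancel] at this
  · intro j hj1 hj2 f hf
    refine addOrderOf_nu_of_coord_ne (coord_eq_zero_of_mem_faceCenters hf) ?_ ?_
    · exact fun h => hj2 (eq_sub_of_add_eq h)
    · intro h
      apply hj1
      clear * - h
      revert j k
      decide
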